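/- Let $(Y,T,Z)$ be a random vector with values in $\mathbb R\times\mathbb R\times\mathbb R^d$ (examination time, event time, covariate), let $\Theta\subset\mathbb R^d$ be compact, $\theta_0$ an interior point of $\Theta$, $0<M<\infty$, and let $\Lambda_0$ be a nondecreasing right-continuous function with $\Lambda_0(0)=0$. Assume: (a) given $Z$, $T$ follows the Cox model with cumulative hazard $e^{\theta_0^TZ}\Lambda_0$, that is, $P(T>t\mid Z)=\exp(-e^{\theta_0^TZ}\Lambda_0(t))$ a.s. for every $t\in[0,\tau]$; (b) $T$ and $Y$ are independent given $Z$; (c) $Z$ lies in a compact set almost surely, and the covariance matrix of $Z-E(Z\mid Y)$ is positive definite; (d) $Y$ has a Lebesgue density which is continuous and positive on its support $[\sigma,\tau]$, and $\Lambda_0(\sigma-)>0$, $\Lambda_0(\tau)<M$. Let $X_1,X_2,\dots$ be i.i.d. copies of $X=(Y,\delta,Z)$, where $\delta=1\{T\le Y\}$. Let $\mathcal H$ be the set of nondecreasing cadlag functions $\Lambda:[\sigma,\tau]\to[0,M]$, and for $\theta\in\Theta$, $\Lambda\in\mathcal H$ put $$\mathrm{lik}_n(\theta,\Lambda)=\prod_{i=1}^n\bigl(1-e^{-e^{\theta^TZ_i}\Lambda(Y_i)}\bigr)^{\delta_i}\bigl(e^{-e^{\theta^TZ_i}\Lambda(Y_i)}\bigr)^{1-\delta_i},\qquad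 pl_n(\theta)=\sup_{\Lambda\in\mathcal H}\mathrm{lik}_n(\theta,\Lambda).$$ Let $\hat\theta_n$ be the maximum likelihood estimator of $\theta$, i.e. the $\theta$-component of a maximizer of $\mathrm{lik}_n$ over $\Theta\times\mathcal H$, and put $\Delta_n(\theta)=n^{-1}\{\log pl_n(\theta)-\log pl_n(\hat\theta_n)\}$. Then for every (random) sequence $\tilde\theta_n\in\Theta$, $\Delta_n(\tilde\theta_n)=o_P(1)$ implies $\tilde\theta_n=\theta_0+o_P(1)$. -/

import Mathlib

open MeasureTheory ProbabilityTheory Filter Topology Set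

noncomputable section

/-- The Euclidean space in which the regression parameter and the covariate vector live. -/
abbrev Covariate (d : ℕ) : Type := EuclideanSpace ℝ (Fin d)

/-- A single current status observation `(y, δ, z)`: the examination time, the indicator that the
event has occurred by the examination time, and the covariate. -/
abbrev Obs (d : ℕ) : Type := ℝ × Bool × Covariate d

/-- The current status observation `(Y, 1{T ≤ Y}, Z)` produced by an examination time `Y`, an event
time `T` and a covariate `Z`. -/
def currentStatus {d : ℕ} {Ω₀ : Type*} (Y T : Ω₀ → ℝ) (Z : Ω₀ → Covariate d) (ω : Ω₀) : Obs d :=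
  (Y ω, open Classical in decide (T ω ≤ Y ω), Z ω)

/-- The nuisance parameter space: nondecreasing cadlag functions on `[σ, τ]` with values in
`[0, M]`. Left limits exist automatically for monotone functions; values off `[σ, τ]` are
irrelevant. -/
def hazardSpace (σ τ M : ℝ) : Set (ℝ → ℝ) :=
  {Λ | MonotoneOn Λ (Icc σ τ) ∧ (∀ y ∈ Icc σ τ, ContinuousWithinAt Λ (Icc y τ) y) ∧
    MapsTo Λ (Icc σ τ) (Icc 0 M)}

/-- The likelihood of one observation `(y, δ, z)`:
`(1 - exp (- e^{θᵀz} Λ(y)))^δ * (exp (- e^{θᵀz} Λ(y)))^(1-δ)`. -/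
def lik {d : ℕ} (θ : Covariate d) (Λ : ℝ → ℝ) (x : Obs d) : ℝ :=
  if x.2.1 then 1 - Real.exp (-(Real.exp (inner ℝ θ x.2.2) * Λ x.1))
  else Real.exp (-(Real.exp (inner ℝ θ x.2.2) * Λ x.1))

/-- The full likelihood of `n` observations. -/
def fullLik {d n : ℕ} (x : Fin n → Obs d) (θ : Covariate d) (Λ : ℝ → ℝ) : ℝ :=
  ∏ i, lik θ Λ (x i)

/-- The profile likelihood `pl_n(θ) = sup_Λ lik_n(θ, Λ)`. -/
def profileLik {d n : ℕ} (σ τ M : ℝ) (x : Fin n → Obs d) (θ : Covariate d) : ℝ :=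
  sSup (fullLik x θ '' hazardSpace σ τ M)

/-- `θhat` is the `θ`-component of a maximizer of the full likelihood over `Θ` times the nuisance
parameter space. -/
def IsMLE {d n : ℕ} (σ τ M : ℝ) (Θ : Set (Covariate d)) (x : Fin n → Obs d)
    (θhat : Covariate d) : Prop :=
  θhat ∈ Θ ∧ ∃ Λhat ∈ hazardSpace σ τ M,
    ∀ θ ∈ Θ, ∀ Λ ∈ hazardSpace σ τ M, fullLik x θ Λ ≤ fullLik x θhat Λhat

/-- `Δ_n(θ) = n⁻¹ (log pl_n(θ) - log pl_n(θhat))`. -/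
def profileDiff {d n : ℕ} (σ τ M : ℝ) (x : Fin n → Obs d) (θhat θ : Covariate d) : ℝ :=
  (n : ℝ)⁻¹ * (Real.log (profileLik σ τ M x θ) - Real.log (profileLik σ τ M x θhat))

/-- The first `n` terms of a sequence of random observations, as a sample of size `n`. -/
def sample {d : ℕ} {Ω : Type*} (X : ℕ → Ω → Obs d) (n : ℕ) (ω : Ω) : Fin n → Obs d :=
  fun i => X i ω

/-- The Cox model with current status data: examination time `Y`, event time `T`, covariate `Z`,
true parameters `(θ₀, Λ₀)`, parameter set `Θ`, known bound `M`, examination window `[σ, τ]`. -/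
structure CoxCurrentStatus {d : ℕ} {Ω₀ : Type*} [MeasurableSpace Ω₀] [StandardBorelSpace Ω₀]
    (P₀ : Measure Ω₀) [IsProbabilityMeasure P₀] (Y T : Ω₀ → ℝ) (Z : Ω₀ → Covariate d)
    (Θ : Set (Covariate d)) (θ₀ : Covariate d) (Λ₀ : ℝ → ℝ) (σ τ M : ℝ) : Prop where
  measurable_Y : Measurable Y
  measurable_T : Measurable T
  measurable_Z : Measurable Z
  isCompact_Θ : IsCompact Θ
  θ₀_mem : θ₀ ∈ interior Θ
  /-- `Λ₀` is a cumulative hazard function: nondecreasing, right-continuous, null at `0`. -/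
  monotone_Λ₀ : Monotone Λ₀
  rightCont_Λ₀ : ∀ y, ContinuousWithinAt Λ₀ (Ici y) y
  Λ₀_zero : Λ₀ 0 = 0
  /-- `Λ₀(σ-) > 0` and `Λ₀(τ) < M`. -/
  leftLim_pos : 0 < Function.leftLim Λ₀ σ
  Λ₀_lt : Λ₀ τ < M
  /-- Given `Z`, the cumulative hazard function of `T` is `t ↦ e^{θ₀ᵀZ} Λ₀(t)`, that is
  `P(T > t | Z) = exp (- e^{θ₀ᵀZ} Λ₀(t))`. The law of `T` after `τ` is left free. -/
  survival : ∀ t ∈ Icc 0 τ,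
    P₀⟦{ω | t < T ω} | MeasurableSpace.comap Z inferInstance⟧ =ᵐ[P₀]
      fun ω => Real.exp (-(Real.exp (inner ℝ θ₀ (Z ω)) * Λ₀ t))
  /-- `T` and `Y` are independent given `Z`. -/
  condIndep : CondIndepFun (MeasurableSpace.comap Z inferInstance) measurable_Z.comap_le T Y P₀
  /-- `Z` lies in a compact set almost surely. -/
  compact_Z : ∃ K : Set (Covariate d), IsCompact K ∧ ∀ᵐ ω ∂P₀, Z ω ∈ K
  /-- The covariance matrix of `Z - E(Z | Y)` is positive definite. -/
  posDef_cov : (Matrix.of fun i j : Fin d =>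
    cov[fun ω => (Z ω - (P₀[Z | MeasurableSpace.comap Y inferInstance]) ω) i,
      fun ω => (Z ω - (P₀[Z | MeasurableSpace.comap Y inferInstance]) ω) j; P₀]).PosDef
  /-- `Y` has a Lebesgue density which is continuous and positive on its support `[σ, τ]`. -/
  density_Y : ∃ f : ℝ → ℝ, ContinuousOn f (Icc σ τ) ∧ (∀ y ∈ Icc σ τ, 0 < f y) ∧
    (∀ y ∉ Icc σ τ, f y = 0) ∧
    P₀.map Y = volume.withDensity (fun y => ENNReal.ofReal (f y))

end

/-! This is a Wald-type consistency argument, carried out uniformly in the nuisance parameter. A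
maximizer has likelihood at least that of `(θ₀, Λ₀)`, so up to `1/n` the profile difference at `θ`
is at most the sample mean of a log likelihood ratio of some `(θ, Λ)` to the truth. It suffices
that, with probability tending to one, these means lie below a fixed negative number for all `Λ` and
all `θ` outside a ball around `θ₀`.

The log ratio is unbounded below, because `Λ` may vanish. It is therefore replaced by the quadratic
`logMajorant`, which dominates it (`log_le_logMajorant`), is Lipschitz, and still has negative mean
(`bernoulli_logMajorant_le`): at most a negative multiple of the mean squared difference of the
event probabilities.

Identifiability: that squared difference controls `E (e^{(θ₀-θ)ᵀZ} - Λ(Y)/Λ₀(Y))²`. Whatever `Λ` is,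
this is at least the mean squared distance of `e^{(θ₀-θ)ᵀZ}` from its conditional expectation given
`Y`, which the covariance condition makes positive (`exists_pos_le_integral_exp_inner_sub_sq`,
`exists_integral_logLikBound_le`).

Uniformity: finitely many brackets of small mean width cover the monotone functions
(`exists_finite_brackets`), the law of large numbers applies to each bracket, and compactness
handles `θ` (`exists_tendsto_measure_of_dist_le`). -/

/-! ### Elementary inequalities for the logarithm and the exponential. -/

/-- A quadratic majorant of the logarithm on `(0, R]`, tangent to it at `1`. -/
noncomputable def logMajorant (R r : ℝ) : ℝ := (r - 1) - (r - 1) ^ 2 / (2 * (R + 1))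

/-- From `log s ≤ s - 1` at `s = √r` one gets `log r ≤ (r - 1) - (√r - 1)²`, and `(√r - 1)² = (r -
1)² / (√r + 1)²` with `(√r + 1)² ≤ 2 (r + 1)`. -/
lemma log_le_logMajorant {R r : ℝ} (hr : 0 < r) (hrR : r ≤ R) :
    Real.log r ≤ logMajorant R r := by
  have hs : 0 < √r := Real.sqrt_pos.2 hr
  have hsq : √r * √r = r := Real.mul_self_sqrt hr.le
  have h1 : Real.log r = 2 * Real.log √r := by
    rw [Real.log_sqrt hr.le]; ring
  have h2 : Real.log √r ≤ √r - 1 := Real.log_le_sub_one_of_pos hs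
  have h3 : (r - 1) ^ 2 / (2 * (R + 1)) ≤ (√r - 1) ^ 2 := by
    rw [div_le_iff₀ (by linarith)]
    have h4 : (r - 1) ^ 2 = (√r - 1) ^ 2 * (√r + 1) ^ 2 := by
      nth_rewrite 1 [← hsq]; ring
    rw [h4]
    refine mul_le_mul_of_nonneg_left ?_ (sq_nonneg _)
    nlinarith [sq_nonneg (√r - 1)]
  unfold logMajorant
  nlinarith

lemma abs_logMajorant_sub_le {R r s : ℝ} (hr : r ∈ Icc 0 R) (hs : s ∈ Icc 0 R) :
    |logMajorant R r - logMajorant R s| ≤ 2 * |r - s| := by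
  have hR : 0 < 2 * (R + 1) := by linarith [hr.1, hr.2]
  have h : logMajorant R r - logMajorant R s = (1 - (r + s - 2) / (2 * (R + 1))) * (r - s) := by
    unfold logMajorant; field_simp; ring
  rw [h, abs_mul]
  refine mul_le_mul_of_nonneg_right ?_ (abs_nonneg _)
  have h1 : (r + s - 2) / (2 * (R + 1)) ≤ 1 := by
    rw [div_le_one hR]; linarith [hr.2, hs.2]
  have h2 : -1 ≤ (r + s - 2) / (2 * (R + 1)) := by
    rw [le_div_iff₀ hR]; linarith [hr.1, hs.1, hr.2]
  rw [abs_le]; constructor <;> linarith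

/-- The linear parts average to zero; the quadratic parts add up to `(q - p)²` times `1/p + 1/(1-p)
≥ 1`. This plays the role of positivity of the Kullback–Leibler divergence. -/
lemma bernoulli_logMajorant_le {R p q : ℝ} (hR : 0 ≤ R) (hp : 0 < p) (hp1 : p < 1) :
    p * logMajorant R (q / p) + (1 - p) * logMajorant R ((1 - q) / (1 - p)) ≤
      -((q - p) ^ 2 / (2 * (R + 1))) := by
  have hp2 : 0 < 1 - p := by linarith
  have h : p * logMajorant R (q / p) + (1 - p) * logMajorant R ((1 - q) / (1 - p)) =
      -((q - p) ^ 2 / (2 * (R + 1)) * (1 / p + 1 / (1 - p))) := by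
    unfold logMajorant; field_simp; ring
  rw [h, neg_le_neg_iff]
  refine le_mul_of_one_le_right (by positivity) ?_
  have : 1 ≤ 1 / p := by rw [le_div_iff₀ hp]; linarith
  have : 0 ≤ 1 / (1 - p) := by positivity
  linarith

lemma abs_exp_neg_sub_exp_neg_le {s t : ℝ} (hs : 0 ≤ s) (ht : 0 ≤ t) :
    |Real.exp (-s) - Real.exp (-t)| ≤ |s - t| := by
  wlog h : s ≤ t generalizing s t
  · rw [abs_sub_comm, abs_sub_comm s]; exact this ht hs (le_of_not_ge h)
  rw [abs_of_nonneg (sub_nonneg.2 (Real.exp_le_exp.2 (neg_le_neg h))),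
    abs_of_nonpos (sub_nonpos.2 h)]
  have h1 : Real.exp (-t) = Real.exp (-s) * Real.exp (-(t - s)) := by
    rw [← Real.exp_add]; congr 1; ring
  have h2 := Real.add_one_le_exp (-(t - s))
  have h3 : Real.exp (-s) ≤ 1 := Real.exp_le_one_iff.2 (by linarith)
  have h4 := Real.exp_pos (-s)
  rw [h1]
  nlinarith

/-- Lower Lipschitz bound: on `(-∞, S]` the derivative of `e^{-s}` is at least `e^{-S}` in absolute
value. It turns a gap between hazards into a gap between probabilities. -/
lemma le_abs_exp_neg_sub_exp_neg {s t S : ℝ} (hs : s ≤ S) (ht : t ≤ S) :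
    Real.exp (-S) * |s - t| ≤ |Real.exp (-s) - Real.exp (-t)| := by
  wlog h : s ≤ t generalizing s t
  · rw [abs_sub_comm, abs_sub_comm (Real.exp _)]; exact this ht hs (le_of_not_ge h)
  rw [abs_of_nonneg (sub_nonneg.2 (Real.exp_le_exp.2 (neg_le_neg h))),
    abs_of_nonpos (sub_nonpos.2 h)]
  have h1 : Real.exp (-s) = Real.exp (-t) * Real.exp (t - s) := by
    rw [← Real.exp_add]; congr 1; ring
  have h2 := Real.add_one_le_exp (t - s)
  have h3 : Real.exp (-S) ≤ Real.exp (-t) := Real.exp_le_exp.2 (by linarith)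
  have h4 := Real.exp_pos (-t)
  rw [h1]
  nlinarith

lemma abs_exp_sub_exp_le {a b B : ℝ} (ha : a ≤ B) (hb : b ≤ B) :
    |Real.exp a - Real.exp b| ≤ Real.exp B * |a - b| := by
  wlog h : b ≤ a generalizing a b
  · rw [abs_sub_comm, abs_sub_comm a]; exact this hb ha (le_of_not_ge h)
  rw [abs_of_nonneg (sub_nonneg.2 (Real.exp_le_exp.2 h)), abs_of_nonneg (sub_nonneg.2 h)]
  have h1 : Real.exp b = Real.exp a * Real.exp (-(a - b)) := by
    rw [← Real.exp_add]; congr 1; ring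
  have h2 := Real.add_one_le_exp (-(a - b))
  have h3 : Real.exp a ≤ Real.exp B := Real.exp_le_exp.2 ha
  have h4 := Real.exp_pos a
  rw [h1]
  nlinarith

/-! ### Identifiability of the regression parameter. -/

/-- The conditional expectation is the best mean square approximation among functions that are
measurable with respect to the smaller σ-algebra. -/
lemma integral_sub_condExp_sq_le {Ω : Type*} {m m₀ : MeasurableSpace Ω} {μ : Measure Ω}
    [IsProbabilityMeasure μ] (hm : m ≤ m₀) {f g : Ω → ℝ} (hf : MemLp f 2 μ) (hg : MemLp g 2 μ)
    (hgm : AEStronglyMeasurable[m] g μ) :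
    ∫ ω, (f ω - (μ[f | m]) ω) ^ 2 ∂μ ≤ ∫ ω, (f ω - g ω) ^ 2 ∂μ := by
  have hfi : Integrable f μ := hf.integrable (by norm_num)
  have hgi : Integrable g μ := hg.integrable (by norm_num)
  have hD : MemLp (f - g) 2 μ := hf.sub hg
  -- Subtracting the `m`-measurable `g` leaves the residual of `f` unchanged, so its mean square is
  -- the integrated conditional variance of `f - g`.
  have h1 : μ[f - g | m] =ᵐ[μ] μ[f | m] - g := by
    refine (condExp_sub hfi hgi m).trans ?_
    exact EventuallyEq.rfl.sub (condExp_of_aestronglyMeasurable' hm hgm hgi)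
  have h2 : ∫ ω, (f ω - (μ[f | m]) ω) ^ 2 ∂μ = ∫ ω, (Var[f - g; μ | m]) ω ∂μ := by
    rw [condVar, integral_condExp hm]
    refine integral_congr_ae ?_
    filter_upwards [h1] with ω hω
    simp [hω]
  rw [h2, ← integral_condExp hm (f := fun ω => (f ω - g ω) ^ 2)]
  refine integral_mono_ae ?_ integrable_condExp (condVar_ae_le_condExp_sq hm hD)
  exact integrable_condExp

/-- Take for `κ` the mean squared residual of `e^{vᵀZ}` given `m`, the least possible value over all
`g`. If it vanished, taking logarithms would make `vᵀZ` almost surely `m`-measurable, so `vᵀ(Z - E(Z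
| m)) = 0` almost surely, against positive definiteness. -/
lemma exists_pos_le_integral_exp_inner_sub_sq {d : ℕ} {Ω₀ : Type*} {m m₀ : MeasurableSpace Ω₀}
    {P₀ : Measure Ω₀} [IsProbabilityMeasure P₀] (hm : m ≤ m₀) {Z : Ω₀ → Covariate d}
    (hZ : Measurable Z) {K : Set (Covariate d)} (hK : IsCompact K) (hZK : ∀ᵐ ω ∂P₀, Z ω ∈ K)
    (hcov : (Matrix.of fun i j : Fin d =>
      cov[fun ω => (Z ω - (P₀[Z | m]) ω) i, fun ω => (Z ω - (P₀[Z | m]) ω) j; P₀]).PosDef)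
    {v : Covariate d} (hv : v ≠ 0) :
    ∃ κ > 0, ∀ g : Ω₀ → ℝ, Measurable[m] g → ∀ C, (∀ ω, |g ω| ≤ C) →
      κ ≤ ∫ ω, (Real.exp (inner ℝ v (Z ω)) - g ω) ^ 2 ∂P₀ := by
  obtain ⟨A, hA⟩ := hK.isBounded.exists_norm_le
  have hZi : Integrable Z P₀ := by
    refine Integrable.of_bound hZ.aestronglyMeasurable A ?_
    filter_upwards [hZK] with ω hω using hA _ hω
  have hZ2 : MemLp Z 2 P₀ := by
    refine MemLp.of_bound hZ.aestronglyMeasurable A ?_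
    filter_upwards [hZK] with ω hω using hA _ hω
  set V : Ω₀ → ℝ := fun ω => inner ℝ v (Z ω) with hVdef
  have hVm : Measurable V := by fun_prop
  have hVb : ∀ᵐ ω ∂P₀, |V ω| ≤ ‖v‖ * A := by
    filter_upwards [hZK] with ω hω
    exact (abs_real_inner_le_norm _ _).trans
      (mul_le_mul_of_nonneg_left (hA _ hω) (norm_nonneg _))
  have hVi : Integrable V P₀ := Integrable.of_bound hVm.aestronglyMeasurable _ hVb
  set f : Ω₀ → ℝ := fun ω => Real.exp (V ω) with hfdef
  have hfm : Measurable f := by fun_prop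
  have hfb : ∀ᵐ ω ∂P₀, ‖f ω‖ ≤ Real.exp (‖v‖ * A) := by
    filter_upwards [hVb] with ω hω
    rw [Real.norm_eq_abs, abs_of_pos (Real.exp_pos _)]
    exact Real.exp_le_exp.2 ((le_abs_self _).trans hω)
  have hf2 : MemLp f 2 P₀ := MemLp.of_bound hfm.aestronglyMeasurable _ hfb
  refine ⟨∫ ω, (f ω - (P₀[f | m]) ω) ^ 2 ∂P₀, ?_, ?_⟩
  · have hfc2 : Integrable (fun ω => (f ω - (P₀[f | m]) ω) ^ 2) P₀ := by
      have : MemLp (f - P₀[f | m]) 2 P₀ := hf2.sub (MemLp.condExp one_le_two hf2)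
      exact this.integrable_sq
    refine lt_of_le_of_ne (integral_nonneg fun ω => sq_nonneg _) fun h0 => ?_
    have h1 := (integral_eq_zero_iff_of_nonneg (fun ω => sq_nonneg _) hfc2).1 h0.symm
    have h2 : V =ᵐ[P₀] fun ω => Real.log ((P₀[f | m]) ω) := by
      filter_upwards [h1] with ω hω
      have : f ω = (P₀[f | m]) ω := by
        simpa [sub_eq_zero] using hω
      rw [← this, hfdef, Real.log_exp]
    have h3 : AEStronglyMeasurable[m] V P₀ := by
      refine ⟨_, ?_, h2⟩
      exact (Real.measurable_log.comp stronglyMeasurable_condExp.measurable).stronglyMeasurable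
    have h4 : P₀[V | m] =ᵐ[P₀] V := condExp_of_aestronglyMeasurable' hm h3 hVi
    have h5 : (fun ω => inner ℝ v ((P₀[Z | m]) ω)) =ᵐ[P₀] P₀[V | m] :=
      (innerSL ℝ v).comp_condExp_comm hZi
    set W : Ω₀ → Covariate d := fun ω => Z ω - (P₀[Z | m]) ω with hWdef
    have hW2 : MemLp W 2 P₀ := hZ2.sub (MemLp.condExp one_le_two hZ2)
    have hWi : ∀ i, MemLp (fun ω => W ω i) 2 P₀ := fun i =>
      (EuclideanSpace.proj (𝕜 := ℝ) i).comp_memLp' hW2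
    have h6 : (∑ i, fun ω => v i * W ω i) =ᵐ[P₀] 0 := by
      filter_upwards [h4, h5] with ω h4 h5
      have : inner ℝ v (W ω) = (0 : ℝ) := by
        rw [hWdef, inner_sub_right, h5, h4, sub_self]
      rw [PiLp.inner_apply] at this
      simpa [mul_comm] using this
    have hv' : v.ofLp ≠ 0 := fun h => hv (by ext i; simpa using congrFun h i)
    have h7 := hcov.dotProduct_mulVec_pos hv'
    have h8 : dotProduct (star v.ofLp) (Matrix.mulVec (Matrix.of fun i j : Fin d =>
        cov[fun ω => W ω i, fun ω => W ω j; P₀]) v.ofLp) =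
        cov[∑ i, fun ω => v i * W ω i, ∑ i, fun ω => v i * W ω i; P₀] := by
      rw [covariance_sum_sum (fun i => (hWi i).const_mul _) (fun i => (hWi i).const_mul _)]
      simp only [covariance_const_mul_left, covariance_const_mul_right, dotProduct,
        Matrix.mulVec, Matrix.of_apply, Pi.star_apply, star_trivial, Finset.mul_sum]
      refine Finset.sum_congr rfl fun i _ => Finset.sum_congr rfl fun j _ => by ring
    rw [h8, covariance_self (by
      exact (memLp_finsetSum' _ fun i _ => (hWi i).const_mul _).aestronglyMeasurable.aemeasurable),
      variance_congr h6, variance_zero] at h7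
    exact lt_irrefl _ h7
  · intro g hg C hC
    refine integral_sub_condExp_sq_le hm hf2 ?_ hg.stronglyMeasurable.aestronglyMeasurable
    exact MemLp.of_bound (hg.mono hm le_rfl).aestronglyMeasurable C (ae_of_all _ hC)

/-! ### Finite brackets for monotone functions. -/

lemma exists_mem_Icc_succ {u : ℕ → ℝ} {y : ℝ} {N : ℕ} (hN : 0 < N) (h0 : u 0 ≤ y) (h1 : y ≤ u N) :
    ∃ j < N, y ∈ Icc (u j) (u (j + 1)) := by
  induction N with
  | zero => exact absurd hN (lt_irrefl 0)
  | succ n ih =>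
    by_cases hy : u n ≤ y
    · exact ⟨n, n.lt_succ_self, hy, h1⟩
    · rcases Nat.eq_zero_or_pos n with rfl | hn
      · exact absurd h0 hy
      · obtain ⟨j, hj, hjy⟩ := ih hn (le_of_not_ge hy)
        exact ⟨j, hj.trans n.lt_succ_self, hjy⟩

/-- The space of hazard functions restricted to finitely many points of `[σ, τ]` has a finite net
that consists of hazard functions. -/
lemma exists_finite_net_hazardSpace {σ τ M ε : ℝ} (hε : 0 < ε) (N : ℕ) {u : ℕ → ℝ}
    (hu : ∀ j ≤ N, u j ∈ Icc σ τ) :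
    ∃ F ⊆ hazardSpace σ τ M, F.Finite ∧
      ∀ Λ ∈ hazardSpace σ τ M, ∃ Λ' ∈ F, ∀ j ≤ N, |Λ (u j) - Λ' (u j)| < ε := by
  set f : (ℝ → ℝ) → (Fin (N + 1) → ℝ) := fun Λ j => Λ (u j) with hf
  have hsub : f '' hazardSpace σ τ M ⊆ Icc (fun _ => 0) (fun _ => M) := by
    rintro _ ⟨Λ, hΛ, rfl⟩
    have h (j : Fin (N + 1)) := hΛ.2.2 (hu j (Nat.lt_succ_iff.1 j.2))
    exact ⟨fun j => (h j).1, fun j => (h j).2⟩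
  have htb : TotallyBounded (f '' hazardSpace σ τ M) :=
    (isCompact_Icc.totallyBounded).subset hsub
  -- The centres of the net can be taken inside the image, so each one is the restriction of an
  -- actual hazard function.
  obtain ⟨t, ht, htfin, hcov⟩ := totallyBounded_iff_subset.1 htb _ (Metric.dist_mem_uniformity hε)
  refine ⟨Function.invFunOn f (hazardSpace σ τ M) '' t, ?_, htfin.image _, fun Λ hΛ => ?_⟩
  · rintro _ ⟨x, hx, rfl⟩
    exact Function.invFunOn_mem (ht hx)
  · obtain ⟨x, hx, hxd⟩ := mem_iUnion₂.1 (hcov (mem_image_of_mem f hΛ))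
    refine ⟨_, mem_image_of_mem _ hx, fun j hj => ?_⟩
    have h1 := Function.invFunOn_eq (ht hx)
    have h2 := (dist_le_pi_dist (f Λ) x ⟨j, Nat.lt_succ_iff.2 hj⟩).trans_lt hxd
    rw [← h1, Real.dist_eq] at h2
    exact h2

/-- For a law on `[σ, τ]` with bounded density, the space of hazard functions can be covered by
finitely many brackets of arbitrarily small mean width. -/
lemma exists_finite_brackets {σ τ M C η : ℝ} (hστ : σ ≤ τ) (hM : 0 ≤ M) (hC : 0 ≤ C) (hη : 0 < η)
    (ν : Measure ℝ) [IsProbabilityMeasure ν] (hν : ∀ a b, a ≤ b → ν.real (Icc a b) ≤ C * (b - a)) :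
    ∃ F : Set ((ℝ → ℝ) × (ℝ → ℝ)), F.Finite ∧
      (∀ p ∈ F, Measurable p.1 ∧ (∀ y, p.1 y ∈ Icc 0 M) ∧ Measurable p.2 ∧
        (∃ B, ∀ y, p.2 y ∈ Icc 0 B) ∧ ∫ y, p.2 y ∂ν ≤ η) ∧
      ∀ Λ ∈ hazardSpace σ τ M, ∃ p ∈ F, ∀ y ∈ Icc σ τ, |Λ y - p.1 y| ≤ p.2 y := by
  -- The mesh is fine enough that a cell has mass at most `C δ` with `M C δ ≤ η / 2`.
  obtain ⟨N, hN⟩ := exists_nat_gt (M * C * (τ - σ) / (η / 2))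
  have hN0 : (0 : ℝ) < N := lt_of_le_of_lt
    (div_nonneg (mul_nonneg (mul_nonneg hM hC) (sub_nonneg.2 hστ)) (by linarith)) hN
  have hNpos : 0 < N := by exact_mod_cast hN0
  set δ : ℝ := (τ - σ) / N with hδ
  have hδ0 : 0 ≤ δ := div_nonneg (sub_nonneg.2 hστ) hN0.le
  have hδN : M * (C * δ) ≤ η / 2 := by
    have := (div_lt_iff₀ (by linarith)).1 hN
    have h2 : M * (C * δ) * N = M * C * (τ - σ) := by rw [hδ]; field_simp
    nlinarith
  set u : ℕ → ℝ := fun j => σ + j * δ with hu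
  have hu0 : u 0 = σ := by simp [hu]
  have huN : u N = τ := by simp only [hu, hδ]; field_simp; ring
  have humono : Monotone u := fun i j hij => by
    have : (i : ℝ) ≤ j := by exact_mod_cast hij
    simp only [hu]; gcongr
  have humem : ∀ j ≤ N, u j ∈ Icc σ τ := fun j hj =>
    ⟨hu0 ▸ humono (Nat.zero_le j), huN ▸ humono hj⟩
  obtain ⟨F, hFH, hFfin, hFnet⟩ := exists_finite_net_hazardSpace (M := M) (half_pos hη) N humem
  -- Bracket width: the net error plus the increment of `Λ` over the cell containing `y`. The
  -- increments telescope to at most `M`, so the mean width is at most `η / 2 + C δ M`. Adjacent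
  -- closed cells share an endpoint, which only enlarges `D`.
  let D : (ℝ → ℝ) → ℝ → ℝ := fun Λ y => η / 2 + ∑ j ∈ Finset.range N,
    (Icc (u j) (u (j + 1))).indicator (fun _ => Λ (u (j + 1)) - Λ (u j)) y
  -- Clamping to `[σ, τ]` makes `Λ ∘ c` monotone on the whole line, hence measurable, with values in
  -- `[0, M]`.
  let c : ℝ → ℝ := fun y => max σ (min τ y)
  have hcmem : ∀ y, c y ∈ Icc σ τ := fun y => ⟨le_max_left _ _, max_le hστ (min_le_left _ _)⟩
  have hcmono : Monotone c := fun a b hab => max_le_max le_rfl (min_le_min le_rfl hab)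
  have hceq : ∀ y ∈ Icc σ τ, c y = y := fun y hy => by
    simp only [c]; rw [min_eq_right hy.2, max_eq_right hy.1]
  have hinc : ∀ Λ ∈ hazardSpace σ τ M, ∀ j ∈ Finset.range N, 0 ≤ Λ (u (j + 1)) - Λ (u j) := by
    intro Λ hΛ j hj
    have hj' := Finset.mem_range.1 hj
    exact sub_nonneg.2 (hΛ.1 (humem j hj'.le) (humem (j + 1) hj') (humono j.le_succ))
  have hsum : ∀ Λ ∈ hazardSpace σ τ M,
      ∑ j ∈ Finset.range N, (Λ (u (j + 1)) - Λ (u j)) ≤ M := by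
    intro Λ hΛ
    rw [Finset.sum_range_sub (fun j => Λ (u j))]
    have h1 := (hΛ.2.2 (humem N le_rfl)).2
    have h2 := (hΛ.2.2 (humem 0 (Nat.zero_le N))).1
    linarith
  refine ⟨(fun Λ => (Λ ∘ c, D Λ)) '' F, hFfin.image _, ?_, ?_⟩
  · rintro _ ⟨Λ, hΛF, rfl⟩
    have hΛ := hFH hΛF
    have hDm : Measurable (D Λ) := by
      refine measurable_const.add (Finset.measurable_fun_sum _ fun j _ => ?_)
      exact measurable_const.indicator measurableSet_Icc
    refine ⟨?_, fun y => hΛ.2.2 (hcmem y), hDm, ⟨η / 2 + M, fun y => ⟨?_, ?_⟩⟩, ?_⟩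
    · have : Monotone (Λ ∘ c) := fun a b hab => hΛ.1 (hcmem a) (hcmem b) (hcmono hab)
      exact this.measurable
    · refine add_nonneg (by linarith) (Finset.sum_nonneg fun j hj => ?_)
      exact indicator_nonneg (fun _ _ => hinc Λ hΛ j hj) _
    · refine add_le_add le_rfl ((Finset.sum_le_sum fun j hj => ?_).trans (hsum Λ hΛ))
      exact indicator_le_self' (fun _ _ => hinc Λ hΛ j hj) _
    · have hi : ∀ j ∈ Finset.range N, Integrable
          ((Icc (u j) (u (j + 1))).indicator fun _ => Λ (u (j + 1)) - Λ (u j)) ν := fun j _ =>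
        (integrable_const _).indicator measurableSet_Icc
      have h1 : ∫ y, D Λ y ∂ν = η / 2 + ∑ j ∈ Finset.range N,
          ν.real (Icc (u j) (u (j + 1))) * (Λ (u (j + 1)) - Λ (u j)) := by
        simp only [D]
        rw [integral_add (integrable_const _) (integrable_finsetSum _ hi),
          integral_finsetSum _ hi]
        simp [integral_indicator_const _ measurableSet_Icc]
      have h2 : ∑ j ∈ Finset.range N,
          ν.real (Icc (u j) (u (j + 1))) * (Λ (u (j + 1)) - Λ (u j)) ≤ C * δ * M := by
        calc _ ≤ ∑ j ∈ Finset.range N, C * δ * (Λ (u (j + 1)) - Λ (u j)) := by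
              refine Finset.sum_le_sum fun j hj => ?_
              refine mul_le_mul_of_nonneg_right ?_ (hinc Λ hΛ j hj)
              refine (hν _ _ (humono j.le_succ)).trans_eq ?_
              simp only [hu]; push_cast; ring
          _ ≤ C * δ * M := by
              rw [← Finset.mul_sum]
              exact mul_le_mul_of_nonneg_left (hsum Λ hΛ) (mul_nonneg hC hδ0)
      simp only [h1]
      linarith
  · intro Λ hΛ
    obtain ⟨Λ', hΛ'F, hclose⟩ := hFnet Λ hΛ
    have hΛ' := hFH hΛ'F
    refine ⟨_, mem_image_of_mem _ hΛ'F, fun y hy => ?_⟩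
    obtain ⟨j, hj, hyj⟩ := exists_mem_Icc_succ hNpos (hu0.le.trans hy.1) (hy.2.trans huN.ge)
    have hD : η / 2 + (Λ' (u (j + 1)) - Λ' (u j)) ≤ D Λ' y := by
      refine add_le_add le_rfl ?_
      refine le_trans (by rw [indicator_of_mem hyj]) (Finset.single_le_sum (f := fun j =>
        (Icc (u j) (u (j + 1))).indicator (fun _ => Λ' (u (j + 1)) - Λ' (u j)) y)
        (fun i hi => indicator_nonneg (fun _ _ => hinc Λ' hΛ' i hi) _) (Finset.mem_range.2 hj))
    refine le_trans ?_ hD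
    simp only [Function.comp_apply, hceq y hy]
    have a1 := hΛ.1 (humem j hj.le) hy hyj.1
    have a2 := hΛ.1 hy (humem (j + 1) hj) hyj.2
    have a3 := hΛ'.1 (humem j hj.le) hy hyj.1
    have a4 := hΛ'.1 hy (humem (j + 1) hj) hyj.2
    have a5 := abs_lt.1 (hclose j hj.le)
    have a6 := abs_lt.1 (hclose (j + 1) hj)
    rw [abs_le]
    constructor <;> linarith [a5.1, a5.2, a6.1, a6.2]

/-! ### The law of a single observation. -/

namespace CoxCurrentStatus

variable {d : ℕ} {Ω₀ : Type*} [MeasurableSpace Ω₀] [StandardBorelSpace Ω₀]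
  {P₀ : Measure Ω₀} [IsProbabilityMeasure P₀] {Y T : Ω₀ → ℝ} {Z : Ω₀ → Covariate d}
  {Θ : Set (Covariate d)} {θ₀ : Covariate d} {Λ₀ : ℝ → ℝ} {σ τ M : ℝ}

lemma Λ₀_pos (h : CoxCurrentStatus P₀ Y T Z Θ θ₀ Λ₀ σ τ M) : 0 < Λ₀ σ :=
  h.leftLim_pos.trans_le (h.monotone_Λ₀.leftLim_le le_rfl)

lemma σ_pos (h : CoxCurrentStatus P₀ Y T Z Θ θ₀ Λ₀ σ τ M) : 0 < σ := by
  by_contra hσ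
  have := h.monotone_Λ₀ (not_lt.1 hσ)
  rw [h.Λ₀_zero] at this
  exact absurd h.Λ₀_pos (not_lt.2 this)

lemma ae_Y_mem (h : CoxCurrentStatus P₀ Y T Z Θ θ₀ Λ₀ σ τ M) : ∀ᵐ ω ∂P₀, Y ω ∈ Icc σ τ := by
  obtain ⟨f, -, -, hf0, hf⟩ := h.density_Y
  have : ∀ᵐ y ∂(P₀.map Y), y ∈ Icc σ τ := by
    rw [ae_iff, hf, withDensity_apply _ (by exact measurableSet_Icc.compl)]
    refine (setLIntegral_congr_fun (by exact measurableSet_Icc.compl) (g := fun _ => 0) ?_).trans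
      (by simp)
    intro y hy
    simp [hf0 y hy]
  exact ae_of_ae_map h.measurable_Y.aemeasurable this

lemma σ_le_τ (h : CoxCurrentStatus P₀ Y T Z Θ θ₀ Λ₀ σ τ M) : σ ≤ τ := by
  obtain ⟨ω, hω⟩ := h.ae_Y_mem.exists
  exact hω.1.trans hω.2

lemma Λ₀_mem_Icc (h : CoxCurrentStatus P₀ Y T Z Θ θ₀ Λ₀ σ τ M) {y : ℝ} (hy : y ∈ Icc σ τ) :
    Λ₀ y ∈ Icc (Λ₀ σ) M :=
  ⟨h.monotone_Λ₀ hy.1, (h.monotone_Λ₀ hy.2).trans h.Λ₀_lt.le⟩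

lemma M_pos (h : CoxCurrentStatus P₀ Y T Z Θ θ₀ Λ₀ σ τ M) : 0 < M :=
  h.Λ₀_pos.trans_le (h.Λ₀_mem_Icc ⟨le_rfl, h.σ_le_τ⟩).2

lemma Λ₀_mem_hazardSpace (h : CoxCurrentStatus P₀ Y T Z Θ θ₀ Λ₀ σ τ M) :
    Λ₀ ∈ hazardSpace σ τ M :=
  ⟨h.monotone_Λ₀.monotoneOn _, fun y _ => (h.rightCont_Λ₀ y).mono Icc_subset_Ici_self,
    fun _ hy => ⟨h.Λ₀_pos.le.trans (h.Λ₀_mem_Icc hy).1, (h.Λ₀_mem_Icc hy).2⟩⟩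

/-- A regular version of the conditional law of the event time given the covariate has the
distribution function of the Cox model on `[0, τ]`. -/
lemma condDistrib_Iic (h : CoxCurrentStatus P₀ Y T Z Θ θ₀ Λ₀ σ τ M) :
    ∀ᵐ ω ∂P₀, ∀ y ∈ Icc 0 τ, (condDistrib T Z P₀ (Z ω)).real (Iic y) =
      1 - Real.exp (-(Real.exp (inner ℝ θ₀ (Z ω)) * Λ₀ y)) := by
  have hpt : ∀ t ∈ Icc 0 τ, ∀ᵐ ω ∂P₀, (condDistrib T Z P₀ (Z ω)).real (Iic t) =
      1 - Real.exp (-(Real.exp (inner ℝ θ₀ (Z ω)) * Λ₀ t)) := by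
    intro t ht
    filter_upwards [condDistrib_ae_eq_condExp (μ := P₀) h.measurable_Z h.measurable_T
      (measurableSet_Ioi (a := t)), h.survival t ht] with ω h1 h2
    have h3 : (condDistrib T Z P₀ (Z ω)).real (Ioi t) =
        Real.exp (-(Real.exp (inner ℝ θ₀ (Z ω)) * Λ₀ t)) := h1.trans h2
    rw [← h3, ← probReal_compl_eq_one_sub measurableSet_Ioi, compl_Ioi]
  -- The null set in `hpt` depends on `t`. Rationals give a common one, and right continuity extends
  -- the identity to all `y < τ`; the endpoint `τ`, which cannot be approached from the right within
  -- `[0, τ]`, is added separately.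
  have hrat : ∀ᵐ ω ∂P₀, ∀ q : ℚ, (q : ℝ) ∈ Icc 0 τ →
      (condDistrib T Z P₀ (Z ω)).real (Iic (q : ℝ)) =
      1 - Real.exp (-(Real.exp (inner ℝ θ₀ (Z ω)) * Λ₀ q)) := by
    refine ae_all_iff.2 fun q => ?_
    by_cases hq : (q : ℝ) ∈ Icc 0 τ
    · filter_upwards [hpt q hq] with ω hω _ using hω
    · exact ae_of_all _ fun ω hq' => absurd hq' hq
  have hτ := hpt τ ⟨h.σ_pos.le.trans h.σ_le_τ, le_rfl⟩
  filter_upwards [hrat, hτ] with ω hω hτω y hy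
  rcases hy.2.eq_or_lt with rfl | hlt
  · exact hτω
  obtain ⟨u, -, hu, hulim⟩ := Real.exists_seq_rat_strictAnti_tendsto y
  have hulim' : Tendsto (fun n => (u n : ℝ)) atTop (𝓝[≥] y) :=
    tendsto_nhdsWithin_iff.2 ⟨hulim, Eventually.of_forall fun n => (hu n).le⟩
  have h1 : Tendsto (fun n => (condDistrib T Z P₀ (Z ω)).real (Iic (u n : ℝ))) atTop
      (𝓝 ((condDistrib T Z P₀ (Z ω)).real (Iic y))) := by
    have := ((cdf (condDistrib T Z P₀ (Z ω))).right_continuous y).tendsto.comp hulim'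
    simpa [Function.comp_def, cdf_eq_real] using this
  have h2 : Tendsto (fun n => 1 - Real.exp (-(Real.exp (inner ℝ θ₀ (Z ω)) * Λ₀ (u n)))) atTop
      (𝓝 (1 - Real.exp (-(Real.exp (inner ℝ θ₀ (Z ω)) * Λ₀ y)))) := by
    have h3 := (h.rightCont_Λ₀ y).tendsto.comp hulim'
    exact tendsto_const_nhds.sub
      ((Real.continuous_exp.tendsto _).comp ((h3.const_mul _).neg))
  refine tendsto_nhds_unique (h1.congr' ?_) h2
  filter_upwards [hulim.eventually (gt_mem_nhds hlt)] with n hn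
  exact hω _ ⟨hy.1.trans (hu n).le, hn.le⟩

/-- By conditional independence the conditional law of `T` given `(Z, Y)` depends on `Z` alone.
Disintegrating, the inner integral over `T` is the Cox distribution function at `Y`. -/
lemma integral_indicator_event (h : CoxCurrentStatus P₀ Y T Z Θ θ₀ Λ₀ σ τ M)
    {g : Covariate d × ℝ → ℝ} (hg : Measurable g)
    (hgi : Integrable (fun ω => g (Z ω, Y ω)) P₀) :
    ∫ ω, {ω | T ω ≤ Y ω}.indicator (fun ω => g (Z ω, Y ω)) ω ∂P₀ =
      ∫ ω, lik θ₀ Λ₀ (Y ω, true, Z ω) * g (Z ω, Y ω) ∂P₀ := by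
  have hY := h.measurable_Y
  have hT := h.measurable_T
  have hZ := h.measurable_Z
  have hZY : Measurable fun ω => (Z ω, Y ω) := hZ.prodMk hY
  set F : (Covariate d × ℝ) × ℝ → ℝ :=
    {w | w.2 ≤ w.1.2}.indicator (fun w => g w.1) with hF
  have hset : MeasurableSet {w : (Covariate d × ℝ) × ℝ | w.2 ≤ w.1.2} :=
    measurableSet_le measurable_snd (measurable_snd.comp measurable_fst)
  have hFm : Measurable F := (hg.comp measurable_fst).indicator hset
  have hlaw := compProd_map_condDistrib (μ := P₀) (mβ := inferInstance) (X := fun ω => (Z ω, Y ω)) hT.aemeasurable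
  have hmap : Measurable fun ω => ((Z ω, Y ω), T ω) := hZY.prodMk hT
  have hFi : Integrable F (P₀.map fun ω => ((Z ω, Y ω), T ω)) := by
    rw [integrable_map_measure hFm.aestronglyMeasurable hmap.aemeasurable]
    exact hgi.indicator (measurableSet_le hT hY)
  have hker := (condIndepFun_iff_condDistrib_prod_ae_eq_prodMkRight (μ := P₀) hT hY hZ).1
    h.condIndep.symm
  calc ∫ ω, {ω | T ω ≤ Y ω}.indicator (fun ω => g (Z ω, Y ω)) ω ∂P₀
      = ∫ w, F w ∂(P₀.map fun ω => ((Z ω, Y ω), T ω)) := by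
        rw [integral_map hmap.aemeasurable hFm.aestronglyMeasurable]
        rfl
    _ = ∫ w, ∫ t, F (w, t) ∂(condDistrib T (fun ω => (Z ω, Y ω)) P₀ w)
          ∂(P₀.map fun ω => (Z ω, Y ω)) := by
        rw [← hlaw] at hFi ⊢
        exact Measure.integral_compProd hFi
    _ = ∫ w, (condDistrib T Z P₀ w.1).real (Iic w.2) * g w ∂(P₀.map fun ω => (Z ω, Y ω)) := by
        refine integral_congr_ae ?_
        filter_upwards [hker] with w hw
        rw [hw, Kernel.prodMkRight_apply]
        have : (fun t => F (w, t)) = (Iic w.2).indicator fun _ => g w := by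
          ext t; simp [hF, indicator]
        rw [this, integral_indicator_const _ measurableSet_Iic, smul_eq_mul]
    _ = ∫ ω, (condDistrib T Z P₀ (Z ω)).real (Iic (Y ω)) * g (Z ω, Y ω) ∂P₀ := by
        rw [integral_map hZY.aemeasurable]
        refine (Measurable.mul ?_ hg).aestronglyMeasurable
        exact (Kernel.measurable_kernel_prodMk_left
          (κ := (condDistrib T Z P₀).prodMkRight ℝ) hset).ennreal_toReal
    _ = ∫ ω, lik θ₀ Λ₀ (Y ω, true, Z ω) * g (Z ω, Y ω) ∂P₀ := by
        refine integral_congr_ae ?_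
        filter_upwards [h.condDistrib_Iic, h.ae_Y_mem] with ω h1 h2
        rw [h1 _ ⟨h.σ_pos.le.trans h2.1, h2.2⟩]
        simp [lik]

/-- The expectation of a function of an observation, computed by first averaging over the event
indicator given the examination time and the covariate. -/
lemma integral_currentStatus (h : CoxCurrentStatus P₀ Y T Z Θ θ₀ Λ₀ σ τ M)
    {G : Obs d → ℝ} (hG : Measurable G) {C : ℝ}
    (hGb : ∀ᵐ ω ∂P₀, ∀ b, |G (Y ω, b, Z ω)| ≤ C) :
    ∫ ω, G (currentStatus Y T Z ω) ∂P₀ =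
      ∫ ω, (lik θ₀ Λ₀ (Y ω, true, Z ω) * G (Y ω, true, Z ω) +
        (1 - lik θ₀ Λ₀ (Y ω, true, Z ω)) * G (Y ω, false, Z ω)) ∂P₀ := by
  have hY := h.measurable_Y
  have hT := h.measurable_T
  have hZ := h.measurable_Z
  have hGm : ∀ b, Measurable fun w : Covariate d × ℝ => G (w.2, b, w.1) := fun b =>
    hG.comp (by fun_prop)
  have hGY : ∀ b, Measurable fun ω => G (Y ω, b, Z ω) := fun b =>
    hG.comp (by fun_prop)
  have hGi : ∀ b, Integrable (fun ω => G (Y ω, b, Z ω)) P₀ := fun b => by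
    refine Integrable.of_bound (hGY b).aestronglyMeasurable C ?_
    filter_upwards [hGb] with ω hω using hω b
  set g : Covariate d × ℝ → ℝ := fun w => G (w.2, true, w.1) - G (w.2, false, w.1) with hg
  have hgm : Measurable g := (hGm true).sub (hGm false)
  have hgi : Integrable (fun ω => g (Z ω, Y ω)) P₀ := (hGi true).sub (hGi false)
  have hTY : MeasurableSet {ω | T ω ≤ Y ω} := measurableSet_le hT hY
  have h1 : ∀ ω, G (currentStatus Y T Z ω) =
      {ω | T ω ≤ Y ω}.indicator (fun ω => g (Z ω, Y ω)) ω + G (Y ω, false, Z ω) := by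
    intro ω
    by_cases hω : T ω ≤ Y ω <;> simp [currentStatus, indicator, hω, hg]
  have hlm : Measurable fun ω => lik θ₀ Λ₀ (Y ω, true, Z ω) := by
    have := h.monotone_Λ₀.measurable
    simp only [lik, if_true]
    fun_prop
  have hlb : ∀ᵐ ω ∂P₀, ‖lik θ₀ Λ₀ (Y ω, true, Z ω)‖ ≤ 1 := by
    filter_upwards [h.ae_Y_mem] with ω hω
    have h0 : 0 ≤ Λ₀ (Y ω) := h.Λ₀_pos.le.trans (h.Λ₀_mem_Icc hω).1
    have h2 : Real.exp (-(Real.exp (inner ℝ θ₀ (Z ω)) * Λ₀ (Y ω))) ≤ 1 :=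
      Real.exp_le_one_iff.2 (neg_nonpos.2 (by positivity))
    have h3 := Real.exp_pos (-(Real.exp (inner ℝ θ₀ (Z ω)) * Λ₀ (Y ω)))
    simp only [lik, if_true, Real.norm_eq_abs, abs_le]
    constructor <;> linarith
  simp_rw [h1]
  rw [integral_add (hgi.indicator hTY) (hGi false), h.integral_indicator_event hgm hgi,
    ← integral_add (hgi.bdd_mul hlm.aestronglyMeasurable hlb) (hGi false)]
  refine integral_congr_ae (ae_of_all _ fun ω => ?_)
  simp only [hg]
  ring

end CoxCurrentStatus

/-! ### Bounds for the likelihood and its majorant. -/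

lemma measurable_lik {d : ℕ} (θ : Covariate d) {Λ : ℝ → ℝ} (hΛ : Measurable Λ) :
    Measurable (lik θ Λ) := by
  unfold lik
  refine Measurable.ite ?_ (by fun_prop) (by fun_prop)
  exact (measurable_fst.comp measurable_snd) (measurableSet_singleton true)

lemma lik_mem_Icc {d : ℕ} {θ : Covariate d} {Λ : ℝ → ℝ} {x : Obs d} (h : 0 ≤ Λ x.1) :
    lik θ Λ x ∈ Icc 0 1 := by
  have h1 : Real.exp (-(Real.exp (inner ℝ θ x.2.2) * Λ x.1)) ≤ 1 :=
    Real.exp_le_one_iff.2 (neg_nonpos.2 (by positivity))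
  have h2 := Real.exp_pos (-(Real.exp (inner ℝ θ x.2.2) * Λ x.1))
  unfold lik
  split_ifs <;> constructor <;> linarith

lemma lik_pos {d : ℕ} {θ : Covariate d} {Λ : ℝ → ℝ} {x : Obs d} (h : 0 < Λ x.1) :
    0 < lik θ Λ x := by
  unfold lik
  split_ifs
  · exact sub_pos.2 (Real.exp_lt_one_iff.2 (neg_lt_zero.2 (by positivity)))
  · exact Real.exp_pos _

lemma lik_false {d : ℕ} (θ : Covariate d) (Λ : ℝ → ℝ) (y : ℝ) (z : Covariate d) :
    lik θ Λ (y, false, z) = 1 - lik θ Λ (y, true, z) := by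
  simp [lik]

lemma abs_lik_sub_lik {d : ℕ} (θ θ' : Covariate d) (Λ Λ' : ℝ → ℝ) (x : Obs d) :
    |lik θ Λ x - lik θ' Λ' x| = |Real.exp (-(Real.exp (inner ℝ θ x.2.2) * Λ x.1)) -
      Real.exp (-(Real.exp (inner ℝ θ' x.2.2) * Λ' x.1))| := by
  unfold lik
  split_ifs
  · rw [abs_sub_comm]; congr 1; ring
  · rfl

/-- The majorant of the log likelihood ratio of `(θ, Λ)` with respect to `(θ₀, Λ₀)`. -/
noncomputable def logLikBound {d : ℕ} (R : ℝ) (θ₀ : Covariate d) (Λ₀ : ℝ → ℝ) (θ : Covariate d)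
    (Λ : ℝ → ℝ) (x : Obs d) : ℝ :=
  logMajorant R (lik θ Λ x / lik θ₀ Λ₀ x)

lemma measurable_logLikBound {d : ℕ} (R : ℝ) (θ₀ θ : Covariate d) {Λ₀ Λ : ℝ → ℝ}
    (hΛ₀ : Measurable Λ₀) (hΛ : Measurable Λ) : Measurable (logLikBound R θ₀ Λ₀ θ Λ) := by
  have h1 := measurable_lik θ hΛ
  have h2 := measurable_lik θ₀ hΛ₀
  unfold logLikBound logMajorant
  fun_prop

section

variable {d : ℕ} {R : ℝ} {θ₀ : Covariate d} {Λ₀ : ℝ → ℝ} {x : Obs d}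

lemma lik_div_mem_Icc (hR : 1 ≤ R * lik θ₀ Λ₀ x) (h0 : 0 < lik θ₀ Λ₀ x) {θ : Covariate d}
    {Λ : ℝ → ℝ} (h : 0 ≤ Λ x.1) : lik θ Λ x / lik θ₀ Λ₀ x ∈ Icc 0 R :=
  ⟨div_nonneg (lik_mem_Icc h).1 h0.le, (div_le_iff₀ h0).2 ((lik_mem_Icc h).2.trans hR)⟩

lemma abs_logLikBound_le (hR : 1 ≤ R * lik θ₀ Λ₀ x) (h0 : 0 < lik θ₀ Λ₀ x) (hR1 : 1 ≤ R)
    {θ : Covariate d} {Λ : ℝ → ℝ} (h : 0 ≤ Λ x.1) : |logLikBound R θ₀ Λ₀ θ Λ x| ≤ 2 * R := by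
  have h1 := lik_div_mem_Icc hR h0 (θ := θ) h
  have h2 := abs_logMajorant_sub_le h1 (⟨zero_le_one, hR1⟩ : (1 : ℝ) ∈ Icc 0 R)
  have h3 : logMajorant R 1 = 0 := by simp [logMajorant]
  rw [h3, sub_zero] at h2
  refine h2.trans (mul_le_mul_of_nonneg_left ?_ zero_le_two)
  rw [abs_le]
  constructor <;> linarith [h1.1, h1.2]

lemma log_div_le_logLikBound (hR : 1 ≤ R * lik θ₀ Λ₀ x) (h0 : 0 < lik θ₀ Λ₀ x)
    {θ : Covariate d} {Λ : ℝ → ℝ} (h : 0 ≤ Λ x.1) (hpos : 0 < lik θ Λ x) :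
    Real.log (lik θ Λ x) - Real.log (lik θ₀ Λ₀ x) ≤ logLikBound R θ₀ Λ₀ θ Λ x := by
  rw [← Real.log_div hpos.ne' h0.ne']
  exact log_le_logMajorant (div_pos hpos h0) (lik_div_mem_Icc hR h0 h).2

/-- A chain of Lipschitz bounds: factor `2` from the majorant, `R` from dividing by the true
likelihood, `1` from `e^{-s}` on `s ≥ 0`, and `e^B` from the relative risk. -/
lemma abs_logLikBound_sub_le (hR : 1 ≤ R * lik θ₀ Λ₀ x) (h0 : 0 < lik θ₀ Λ₀ x) (hR1 : 1 ≤ R)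
    {θ θ' : Covariate d} {Λ Λ' : ℝ → ℝ} {M A B : ℝ} (hΛ : Λ x.1 ∈ Icc 0 M) (hΛ' : Λ' x.1 ∈ Icc 0 M)
    (hθ : inner ℝ θ x.2.2 ≤ B) (hθ' : inner ℝ θ' x.2.2 ≤ B) (hx : ‖x.2.2‖ ≤ A) :
    |logLikBound R θ₀ Λ₀ θ Λ x - logLikBound R θ₀ Λ₀ θ' Λ' x| ≤
      2 * R * Real.exp B * (|Λ x.1 - Λ' x.1| + M * A * ‖θ - θ'‖) := by
  have hM : 0 ≤ M := hΛ.1.trans hΛ.2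
  have h1 := abs_logMajorant_sub_le (lik_div_mem_Icc hR h0 (θ := θ) hΛ.1)
    (lik_div_mem_Icc hR h0 (θ := θ') hΛ'.1)
  have h2 : |lik θ Λ x / lik θ₀ Λ₀ x - lik θ' Λ' x / lik θ₀ Λ₀ x| ≤
      R * |lik θ Λ x - lik θ' Λ' x| := by
    rw [← sub_div, abs_div, abs_of_pos h0, div_le_iff₀ h0]
    nlinarith [abs_nonneg (lik θ Λ x - lik θ' Λ' x)]
  have h3 : |lik θ Λ x - lik θ' Λ' x| ≤
      |Real.exp (inner ℝ θ x.2.2) * Λ x.1 - Real.exp (inner ℝ θ' x.2.2) * Λ' x.1| := by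
    rw [abs_lik_sub_lik]
    exact abs_exp_neg_sub_exp_neg_le (mul_nonneg (Real.exp_pos _).le hΛ.1)
      (mul_nonneg (Real.exp_pos _).le hΛ'.1)
  have h4 : |Real.exp (inner ℝ θ x.2.2) * Λ x.1 - Real.exp (inner ℝ θ' x.2.2) * Λ' x.1| ≤
      Real.exp B * |Λ x.1 - Λ' x.1| + Real.exp B * (‖θ - θ'‖ * A) * M := by
    have h5 : Real.exp (inner ℝ θ x.2.2) * Λ x.1 - Real.exp (inner ℝ θ' x.2.2) * Λ' x.1 =
        Real.exp (inner ℝ θ x.2.2) * (Λ x.1 - Λ' x.1) +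
        (Real.exp (inner ℝ θ x.2.2) - Real.exp (inner ℝ θ' x.2.2)) * Λ' x.1 := by ring
    rw [h5]
    refine (abs_add_le _ _).trans (add_le_add ?_ ?_)
    · rw [abs_mul, abs_of_pos (Real.exp_pos _)]
      exact mul_le_mul_of_nonneg_right (Real.exp_le_exp.2 hθ) (abs_nonneg _)
    · rw [abs_mul, abs_of_nonneg hΛ'.1]
      refine mul_le_mul ?_ hΛ'.2 hΛ'.1 (by
        have := (norm_nonneg _).trans hx
        positivity)
      refine (abs_exp_sub_exp_le hθ hθ').trans ?_
      refine mul_le_mul_of_nonneg_left ?_ (Real.exp_pos _).le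
      rw [← inner_sub_left]
      exact (abs_real_inner_le_norm _ _).trans (mul_le_mul_of_nonneg_left hx (norm_nonneg _))
  have h6 : R * |lik θ Λ x - lik θ' Λ' x| ≤
      R * (Real.exp B * |Λ x.1 - Λ' x.1| + Real.exp B * (‖θ - θ'‖ * A) * M) :=
    mul_le_mul_of_nonneg_left (h3.trans h4) (by linarith)
  unfold logLikBound
  linarith

end

/-! ### Separation of the truth from other regression parameters. -/

namespace CoxCurrentStatus

variable {d : ℕ} {Ω₀ : Type*} [MeasurableSpace Ω₀] [StandardBorelSpace Ω₀]
  {P₀ : Measure Ω₀} [IsProbabilityMeasure P₀] {Y T : Ω₀ → ℝ} {Z : Ω₀ → Covariate d}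
  {Θ : Set (Covariate d)} {θ₀ : Covariate d} {Λ₀ : ℝ → ℝ} {σ τ M : ℝ}

/-- On the support, `Λ₀ ≥ Λ₀ σ > 0` keeps the event probability away from zero and `Λ₀ ≤ M` does so
for its complement. Likelihoods being at most one, `R` then bounds all likelihood ratios. -/
lemma exists_le_lik (h : CoxCurrentStatus P₀ Y T Z Θ θ₀ Λ₀ σ τ M) {K : Set (Covariate d)} {B : ℝ}
    (hB : ∀ z ∈ K, |inner ℝ θ₀ z| ≤ B) :
    ∃ R ≥ 1, ∀ x : Obs d, x.1 ∈ Icc σ τ → x.2.2 ∈ K → 1 ≤ R * lik θ₀ Λ₀ x := by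
  set b₁ : ℝ := 1 - Real.exp (-(Real.exp (-B) * Λ₀ σ)) with hb₁
  set b₂ : ℝ := Real.exp (-(Real.exp B * M)) with hb₂
  have hb₁0 : 0 < b₁ := by
    have := h.Λ₀_pos
    exact sub_pos.2 (Real.exp_lt_one_iff.2 (neg_lt_zero.2 (by positivity)))
  have hb₂0 : 0 < b₂ := Real.exp_pos _
  refine ⟨max 1 (max (1 / b₁) (1 / b₂)), le_max_left _ _, fun x hx hz => ?_⟩
  have hBx := abs_le.1 (hB _ hz)
  have hΛ := h.Λ₀_mem_Icc hx
  have hR1 : 1 / b₁ ≤ max 1 (max (1 / b₁) (1 / b₂)) := (le_max_left _ _).trans (le_max_right _ _)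
  have hR2 : 1 / b₂ ≤ max 1 (max (1 / b₁) (1 / b₂)) := (le_max_right _ _).trans (le_max_right _ _)
  have key : ∀ b R : ℝ, 0 < b → 1 / b ≤ R → b ≤ lik θ₀ Λ₀ x → 1 ≤ R * lik θ₀ Λ₀ x := by
    intro b R hb hR hl
    calc (1 : ℝ) = 1 / b * b := by field_simp
      _ ≤ R * lik θ₀ Λ₀ x := mul_le_mul hR hl hb.le ((by positivity : 0 ≤ 1 / b).trans hR)
  by_cases hδ : x.2.1
  · refine key b₁ _ hb₁0 hR1 ?_
    simp only [lik, hδ, if_true, hb₁]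
    refine sub_le_sub_left (Real.exp_le_exp.2 (neg_le_neg ?_)) _
    exact mul_le_mul (Real.exp_le_exp.2 hBx.1) hΛ.1 h.Λ₀_pos.le (Real.exp_pos _).le
  · refine key b₂ _ hb₂0 hR2 ?_
    simp only [lik, hδ, hb₂]
    refine Real.exp_le_exp.2 (neg_le_neg ?_)
    exact mul_le_mul (Real.exp_le_exp.2 hBx.2) hΛ.2 (h.Λ₀_pos.le.trans hΛ.1) (Real.exp_pos _).le

/-- The mean of the majorant of the log likelihood ratio is bounded away from zero, uniformly in
the nuisance parameter, at every regression parameter other than the true one. -/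
lemma exists_integral_logLikBound_le (h : CoxCurrentStatus P₀ Y T Z Θ θ₀ Λ₀ σ τ M)
    {K : Set (Covariate d)} (hK : IsCompact K) (hZK : ∀ᵐ ω ∂P₀, Z ω ∈ K) {B R : ℝ}
    (hB₀ : ∀ z ∈ K, |inner ℝ θ₀ z| ≤ B) (hR1 : 1 ≤ R)
    (hR : ∀ x : Obs d, x.1 ∈ Icc σ τ → x.2.2 ∈ K → 1 ≤ R * lik θ₀ Λ₀ x)
    {θ : Covariate d} (hB : ∀ z ∈ K, |inner ℝ θ z| ≤ B) (hθ : θ ≠ θ₀) :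
    ∃ κ > 0, ∀ Λ : ℝ → ℝ, Measurable Λ → (∀ y, Λ y ∈ Icc 0 M) →
      ∫ ω, logLikBound R θ₀ Λ₀ θ Λ (currentStatus Y T Z ω) ∂P₀ ≤ -κ := by
  have hY := h.measurable_Y
  have hZ := h.measurable_Z
  have hΛ₀m : Measurable Λ₀ := h.monotone_Λ₀.measurable
  have hΛpos := h.Λ₀_pos
  have hM := h.M_pos
  obtain ⟨κ, hκ, hκle⟩ := exists_pos_le_integral_exp_inner_sub_sq hY.comap_le hZ hK hZK
    h.posDef_cov (sub_ne_zero.2 hθ.symm)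
  set S : ℝ := Real.exp B * M with hS
  set c : ℝ := (Real.exp (-S) * (Real.exp (-B) * Λ₀ σ)) ^ 2 / (2 * (R + 1)) with hc
  have hc0 : 0 < c := by positivity
  refine ⟨c * κ, mul_pos hc0 hκ, fun Λ hΛm hΛ => ?_⟩
  -- On `[σ, τ]` this is `Λ / Λ₀`; the maximum keeps it bounded everywhere.
  set g : ℝ → ℝ := fun y => Λ y / max (Λ₀ y) (Λ₀ σ) with hg
  have hgm : Measurable g := by fun_prop
  have hgb : ∀ y, |g y| ≤ M / Λ₀ σ := fun y => by
    have h1 : 0 < max (Λ₀ y) (Λ₀ σ) := lt_max_of_lt_right hΛpos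
    rw [abs_of_nonneg (div_nonneg (hΛ y).1 h1.le)]
    exact div_le_div₀ hM.le (hΛ y).2 hΛpos (le_max_right _ _)
  set E : Ω₀ → ℝ := fun ω => (Real.exp (inner ℝ (θ₀ - θ) (Z ω)) - g (Y ω)) ^ 2 with hE
  have hκg : κ ≤ ∫ ω, E ω ∂P₀ :=
    hκle (fun ω => g (Y ω)) (hgm.comp (comap_measurable Y)) _ fun ω => hgb _
  have hGm := measurable_logLikBound R θ₀ θ hΛ₀m hΛm
  have hgood : ∀ᵐ ω ∂P₀, Y ω ∈ Icc σ τ ∧ Z ω ∈ K := h.ae_Y_mem.and hZK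
  have hl0 : ∀ x : Obs d, x.1 ∈ Icc σ τ → 0 < lik θ₀ Λ₀ x := fun x hx =>
    lik_pos (hΛpos.trans_le (h.Λ₀_mem_Icc hx).1)
  have hGb : ∀ᵐ ω ∂P₀, ∀ b, |logLikBound R θ₀ Λ₀ θ Λ (Y ω, b, Z ω)| ≤ 2 * R := by
    filter_upwards [hgood] with ω hω b
    exact abs_logLikBound_le (hR _ hω.1 hω.2) (hl0 _ hω.1) hR1 (hΛ _).1
  rw [h.integral_currentStatus hGm hGb]
  have hpt : ∀ᵐ ω ∂P₀, lik θ₀ Λ₀ (Y ω, true, Z ω) * logLikBound R θ₀ Λ₀ θ Λ (Y ω, true, Z ω) +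
      (1 - lik θ₀ Λ₀ (Y ω, true, Z ω)) * logLikBound R θ₀ Λ₀ θ Λ (Y ω, false, Z ω) ≤
      -(c * E ω) := by
    filter_upwards [hgood] with ω hω
    have hp := hl0 (Y ω, true, Z ω) hω.1
    have hp1 : lik θ₀ Λ₀ (Y ω, true, Z ω) < 1 := by
      have := hl0 (Y ω, false, Z ω) hω.1
      rw [lik_false] at this
      linarith
    have h1 := bernoulli_logMajorant_le (q := lik θ Λ (Y ω, true, Z ω))
      (zero_le_one.trans hR1) hp hp1
    have hlf : logLikBound R θ₀ Λ₀ θ Λ (Y ω, false, Z ω) =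
        logMajorant R ((1 - lik θ Λ (Y ω, true, Z ω)) / (1 - lik θ₀ Λ₀ (Y ω, true, Z ω))) := by
      rw [logLikBound, lik_false, lik_false]
    rw [hlf]
    refine h1.trans (neg_le_neg ?_)
    rw [hc, div_mul_eq_mul_div]
    refine div_le_div_of_nonneg_right ?_ (by linarith)
    rw [hE, ← mul_pow, ← sq_abs (lik θ Λ _ - _), ← sq_abs (_ * (_ : ℝ))]
    refine pow_le_pow_left₀ (abs_nonneg _) ?_ 2
    rw [abs_lik_sub_lik]
    have hΛ₀Y := h.Λ₀_mem_Icc hω.1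
    have hBθ := abs_le.1 (hB _ hω.2)
    have hBθ₀ := abs_le.1 (hB₀ _ hω.2)
    refine le_trans ?_ (le_abs_exp_neg_sub_exp_neg (S := S)
      (mul_le_mul (Real.exp_le_exp.2 hBθ.2) (hΛ _).2 (hΛ _).1 (Real.exp_pos _).le)
      (mul_le_mul (Real.exp_le_exp.2 hBθ₀.2) hΛ₀Y.2 (hΛpos.le.trans hΛ₀Y.1) (Real.exp_pos _).le))
    rw [mul_assoc, abs_mul, abs_of_pos (Real.exp_pos (-S))]
    refine mul_le_mul_of_nonneg_left ?_ (Real.exp_pos _).le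
    -- Factoring out `e^{θᵀZ} Λ₀(Y)`, which is bounded below, leaves the approximation of
    -- `e^{(θ₀-θ)ᵀZ}` by a function of `Y` that `hκle` controls.
    have hfac : Real.exp (inner ℝ θ (Z ω)) * Λ (Y ω) - Real.exp (inner ℝ θ₀ (Z ω)) * Λ₀ (Y ω) =
        -(Real.exp (inner ℝ θ (Z ω)) * Λ₀ (Y ω) *
          (Real.exp (inner ℝ (θ₀ - θ) (Z ω)) - g (Y ω))) := by
      have hne : Λ₀ (Y ω) ≠ 0 := (hΛpos.trans_le hΛ₀Y.1).ne'
      have hexp : Real.exp (inner ℝ θ₀ (Z ω)) =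
          Real.exp (inner ℝ θ (Z ω)) * Real.exp (inner ℝ (θ₀ - θ) (Z ω)) := by
        rw [← Real.exp_add, inner_sub_left]; congr 1; ring
      simp only [hg, max_eq_left hΛ₀Y.1]
      rw [hexp]
      field_simp
      ring
    rw [hfac, abs_neg, abs_mul, abs_mul _ (_ - _)]
    refine mul_le_mul_of_nonneg_right ?_ (abs_nonneg _)
    rw [abs_of_pos (mul_pos (Real.exp_pos _) hΛpos),
      abs_of_pos (mul_pos (Real.exp_pos _) (hΛpos.trans_le hΛ₀Y.1))]
    exact mul_le_mul (Real.exp_le_exp.2 hBθ.1) hΛ₀Y.1 hΛpos.le (Real.exp_pos _).le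
  have hEm : Measurable E := by fun_prop
  have hEi : Integrable E P₀ := by
    refine Integrable.of_bound hEm.aestronglyMeasurable ((Real.exp (2 * B) + M / Λ₀ σ) ^ 2) ?_
    filter_upwards [hgood] with ω hω
    rw [hE, norm_pow]
    refine pow_le_pow_left₀ (norm_nonneg _) ((norm_sub_le _ _).trans (add_le_add ?_ (hgb _))) 2
    rw [Real.norm_eq_abs, abs_of_pos (Real.exp_pos _), Real.exp_le_exp, inner_sub_left]
    linarith [(abs_le.1 (hB _ hω.2)).1, (abs_le.1 (hB₀ _ hω.2)).2]
  have hmeas : ∀ b, Measurable fun ω => logLikBound R θ₀ Λ₀ θ Λ (Y ω, b, Z ω) := fun b =>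
    hGm.comp (by fun_prop)
  have hlm : Measurable fun ω => lik θ₀ Λ₀ (Y ω, true, Z ω) :=
    (measurable_lik θ₀ hΛ₀m).comp (by fun_prop)
  have hLi : Integrable (fun ω => lik θ₀ Λ₀ (Y ω, true, Z ω) *
      logLikBound R θ₀ Λ₀ θ Λ (Y ω, true, Z ω) +
      (1 - lik θ₀ Λ₀ (Y ω, true, Z ω)) * logLikBound R θ₀ Λ₀ θ Λ (Y ω, false, Z ω)) P₀ := by
    refine Integrable.of_bound ((hlm.mul (hmeas true)).add
      ((measurable_const.sub hlm).mul (hmeas false))).aestronglyMeasurable (2 * R + 2 * R) ?_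
    filter_upwards [hgood, hGb] with ω hω hb
    have hl := lik_mem_Icc (θ := θ₀) (x := (Y ω, true, Z ω))
      (hΛpos.le.trans (h.Λ₀_mem_Icc hω.1).1)
    refine (norm_add_le _ _).trans (add_le_add ?_ ?_)
    · rw [norm_mul, Real.norm_eq_abs, Real.norm_eq_abs, abs_of_nonneg hl.1]
      exact (mul_le_of_le_one_left (abs_nonneg _) hl.2).trans (hb true)
    · rw [norm_mul, Real.norm_eq_abs, Real.norm_eq_abs, abs_of_nonneg (sub_nonneg.2 hl.2)]
      exact (mul_le_of_le_one_left (abs_nonneg _) (by linarith [hl.1])).trans (hb false)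
  refine (integral_mono_ae hLi (hEi.const_mul c).neg hpt).trans ?_
  simp only [Pi.neg_apply]
  rw [integral_neg, integral_const_mul]
  exact neg_le_neg (mul_le_mul_of_nonneg_left hκg hc0.le)

end CoxCurrentStatus

/-! ### Uniform law of large numbers. -/

/-- A sample mean eventually stays below any number larger than the expectation. -/
lemma tendsto_measure_le_sampleMean {𝓧 Ω Ω₀ : Type*} [MeasurableSpace 𝓧] [MeasurableSpace Ω]
    [MeasurableSpace Ω₀] {P : Measure Ω} [IsProbabilityMeasure P] {P₀ : Measure Ω₀}
    {X : ℕ → Ω → 𝓧} {W : Ω₀ → 𝓧} (hindep : iIndepFun X P)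
    (hident : ∀ i, IdentDistrib (X i) W P P₀) {U : 𝓧 → ℝ} (hU : Measurable U)
    (hUi : Integrable (fun ω => U (W ω)) P₀) {a : ℝ} (ha : ∫ ω, U (W ω) ∂P₀ < a) :
    Tendsto (fun n : ℕ => P {ω | a ≤ (∑ i ∈ Finset.range n, U (X i ω)) / n}) atTop (𝓝 0) := by
  have hid : ∀ i, IdentDistrib (fun ω => U (X i ω)) (fun ω => U (W ω)) P P₀ := fun i =>
    (hident i).comp hU
  have hlln := strong_law_ae_real (μ := P) (fun i ω => U (X i ω)) ((hid 0).integrable_iff.2 hUi)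
    (fun i j hij => (hindep.indepFun hij).comp hU hU) (fun i => (hid i).trans (hid 0).symm)
  have hmeas : ∀ n : ℕ, AEStronglyMeasurable
      (fun ω => (∑ i ∈ Finset.range n, U (X i ω)) / n) P := fun n =>
    ((Finset.aemeasurable_fun_sum _ fun i _ =>
      (hid i).aemeasurable_fst).div_const _).aestronglyMeasurable
  have hm := tendstoInMeasure_iff_dist.1 (tendstoInMeasure_of_tendsto_ae hmeas hlln) _
    (sub_pos.2 ha)
  refine tendsto_of_tendsto_of_tendsto_of_le_of_le tendsto_const_nhds hm
    (fun n => zero_le) (fun n => measure_mono fun ω hω => ?_)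
  simp only [mem_ofPred_eq, (hid 0).integral_eq] at hω ⊢
  rw [Real.dist_eq]
  exact (sub_le_sub_right hω _).trans (le_abs_self _)

namespace CoxCurrentStatus

variable {d : ℕ} {Ω₀ : Type*} [MeasurableSpace Ω₀] [StandardBorelSpace Ω₀]
  {P₀ : Measure Ω₀} [IsProbabilityMeasure P₀] {Y T : Ω₀ → ℝ} {Z : Ω₀ → Covariate d}
  {Θ : Set (Covariate d)} {θ₀ : Covariate d} {Λ₀ : ℝ → ℝ} {σ τ M : ℝ}

lemma exists_map_Y_Icc_le (h : CoxCurrentStatus P₀ Y T Z Θ θ₀ Λ₀ σ τ M) :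
    ∃ C ≥ 0, ∀ a b, a ≤ b → (P₀.map Y).real (Icc a b) ≤ C * (b - a) := by
  obtain ⟨f, hfc, -, hf0, hf⟩ := h.density_Y
  obtain ⟨C, hC⟩ := isCompact_Icc.exists_bound_of_continuousOn hfc
  have hC0 : 0 ≤ max C 0 := le_max_right _ _
  have hfC : ∀ y, f y ≤ max C 0 := fun y => by
    by_cases hy : y ∈ Icc σ τ
    · exact ((le_abs_self _).trans (hC y hy)).trans (le_max_left _ _)
    · rw [hf0 y hy]; exact hC0
  refine ⟨max C 0, hC0, fun a b hab => ?_⟩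
  rw [hf, measureReal_def, withDensity_apply _ measurableSet_Icc]
  refine ENNReal.toReal_le_of_le_ofReal (mul_nonneg hC0 (sub_nonneg.2 hab)) ?_
  calc ∫⁻ y in Icc a b, ENNReal.ofReal (f y)
      ≤ ∫⁻ _ in Icc a b, ENNReal.ofReal (max C 0) :=
        lintegral_mono fun y => ENNReal.ofReal_le_ofReal (hfC y)
    _ = ENNReal.ofReal (max C 0 * (b - a)) := by
        rw [setLIntegral_const, Real.volume_Icc, ENNReal.ofReal_mul hC0]

variable {Ω : Type*} [MeasurableSpace Ω] {P : Measure Ω} {X : ℕ → Ω → Obs d}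

lemma ae_sample_mem (h : CoxCurrentStatus P₀ Y T Z Θ θ₀ Λ₀ σ τ M)
    (hident : ∀ i, IdentDistrib (X i) (currentStatus Y T Z) P P₀)
    {K : Set (Covariate d)} (hK : IsCompact K) (hZK : ∀ᵐ ω ∂P₀, Z ω ∈ K) :
    ∀ᵐ ω ∂P, ∀ i, (X i ω).1 ∈ Icc σ τ ∧ (X i ω).2.2 ∈ K := by
  refine ae_all_iff.2 fun i => ?_
  have hG : MeasurableSet {x : Obs d | x.1 ∈ Icc σ τ ∧ x.2.2 ∈ K} :=
    (measurable_fst measurableSet_Icc).inter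
      ((measurable_snd.comp measurable_snd) hK.measurableSet)
  exact (hident i).symm.ae_snd hG (h.ae_Y_mem.and hZK)

variable [IsProbabilityMeasure P]

/-- Near a regression parameter other than the true one, the sample mean of the majorant of the
log likelihood ratio is bounded away from zero from above with probability tending to one,
uniformly in the nuisance parameter. -/
lemma exists_nhds_tendsto_measure (h : CoxCurrentStatus P₀ Y T Z Θ θ₀ Λ₀ σ τ M)
    (hindep : iIndepFun X P) (hident : ∀ i, IdentDistrib (X i) (currentStatus Y T Z) P P₀)
    {K : Set (Covariate d)} (hK : IsCompact K) (hZK : ∀ᵐ ω ∂P₀, Z ω ∈ K) {A B R : ℝ}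
    (hA : ∀ z ∈ K, ‖z‖ ≤ A) (hB : ∀ θ ∈ Θ, ∀ z ∈ K, |inner ℝ θ z| ≤ B) (hR1 : 1 ≤ R)
    (hR : ∀ x : Obs d, x.1 ∈ Icc σ τ → x.2.2 ∈ K → 1 ≤ R * lik θ₀ Λ₀ x)
    {θ : Covariate d} (hθΘ : θ ∈ Θ) (hθ : θ ≠ θ₀) :
    ∃ ρ > 0, ∃ c > 0, Tendsto (fun n : ℕ => P {ω | ∃ θ' ∈ Θ ∩ Metric.ball θ ρ,
      ∃ Λ ∈ hazardSpace σ τ M,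
        -c ≤ (∑ i ∈ Finset.range n, logLikBound R θ₀ Λ₀ θ' Λ (X i ω)) / n}) atTop (𝓝 0) := by
  have hY := h.measurable_Y
  have hM := h.M_pos
  have hΛ₀m : Measurable Λ₀ := h.monotone_Λ₀.measurable
  obtain ⟨ω₀, hω₀⟩ := hZK.exists
  have hA0 : 0 ≤ A := (norm_nonneg _).trans (hA _ hω₀)
  obtain ⟨κ, hκ, hκle⟩ := h.exists_integral_logLikBound_le hK hZK
    (hB θ₀ (interior_subset h.θ₀_mem)) hR1 hR (hB θ hθΘ) hθ
  obtain ⟨C, hC0, hC⟩ := h.exists_map_Y_Icc_le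
  set L : ℝ := 2 * R * Real.exp B with hL
  have hL0 : 0 < L := by positivity
  -- Bracket width and radius each cost at most `κ / 4` in the mean, so the bracketed mean is at
  -- most `-κ / 2`, strictly below the threshold `-κ / 4`. The `+ 1` in `ρ` avoids a zero
  -- denominator when `A = 0`.
  set η : ℝ := κ / (4 * L) with hη
  have hη0 : 0 < η := by positivity
  set ρ : ℝ := κ / (4 * L * (M * A + 1)) with hρ
  have hρ0 : 0 < ρ := by positivity
  have hLη : L * η = κ / 4 := by rw [hη]; field_simp
  have hLρ : L * (M * A * ρ) ≤ κ / 4 := by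
    have h1 : L * ((M * A + 1) * ρ) = κ / 4 := by
      have : M * A + 1 ≠ 0 := by positivity
      rw [hρ]; field_simp
    nlinarith [mul_pos hL0 hρ0]
  have : IsProbabilityMeasure (P₀.map Y) := Measure.isProbabilityMeasure_map hY.aemeasurable
  obtain ⟨F, hFfin, hF, hFcov⟩ := exists_finite_brackets h.σ_le_τ hM.le hC0 hη0 (P₀.map Y) hC
  let U : (ℝ → ℝ) × (ℝ → ℝ) → Obs d → ℝ := fun p x =>
    logLikBound R θ₀ Λ₀ θ p.1 x + L * (p.2 x.1 + M * A * ρ)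
  have hl0 : ∀ x : Obs d, x.1 ∈ Icc σ τ → 0 < lik θ₀ Λ₀ x := fun x hx =>
    lik_pos (h.Λ₀_pos.trans_le (h.Λ₀_mem_Icc hx).1)
  have hcs : AEMeasurable (currentStatus Y T Z) P₀ := (hident 0).aemeasurable_snd
  have hlim : ∀ p ∈ F, Tendsto (fun n : ℕ =>
      P {ω | -(κ / 4) ≤ (∑ i ∈ Finset.range n, U p (X i ω)) / n}) atTop (𝓝 0) := by
    intro p hp
    obtain ⟨h1m, h1, h2m, ⟨b, hb⟩, hint⟩ := hF p hp
    have hφm := measurable_logLikBound R θ₀ θ hΛ₀m h1m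
    have hφi : Integrable (fun ω => logLikBound R θ₀ Λ₀ θ p.1 (currentStatus Y T Z ω)) P₀ := by
      refine Integrable.of_bound (hφm.comp_aemeasurable hcs).aestronglyMeasurable (2 * R) ?_
      filter_upwards [h.ae_Y_mem, hZK] with ω hω1 hω2
      exact abs_logLikBound_le (hR _ hω1 hω2) (hl0 _ hω1) hR1 (h1 _).1
    have hDi : Integrable (fun ω => p.2 (Y ω)) P₀ :=
      Integrable.of_bound (h2m.comp hY).aestronglyMeasurable b (ae_of_all _ fun ω => by
        rw [Real.norm_eq_abs, abs_of_nonneg (hb _).1]; exact (hb _).2)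
    have hDi' : Integrable (fun ω => L * (p.2 (Y ω) + M * A * ρ)) P₀ :=
      (hDi.add (integrable_const _)).const_mul L
    refine tendsto_measure_le_sampleMean hindep hident (U := U p)
      (hφm.add (((h2m.comp measurable_fst).add_const _).const_mul L)) (hφi.add hDi') ?_
    have hD : ∫ ω, p.2 (Y ω) ∂P₀ ≤ η := by
      rwa [integral_map hY.aemeasurable h2m.aestronglyMeasurable] at hint
    have h3 : ∫ ω, U p (currentStatus Y T Z ω) ∂P₀ =
        ∫ ω, logLikBound R θ₀ Λ₀ θ p.1 (currentStatus Y T Z ω) ∂P₀ +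
          L * (∫ ω, p.2 (Y ω) ∂P₀ + M * A * ρ) := by
      have h4 := integral_add hφi hDi'
      rw [integral_const_mul, integral_add hDi (integrable_const _), integral_const] at h4
      simpa [U, currentStatus] using h4
    rw [h3]
    have h5 := hκle p.1 h1m h1
    have h6 : L * ∫ ω, p.2 (Y ω) ∂P₀ ≤ L * η := mul_le_mul_of_nonneg_left hD hL0.le
    linarith
  refine ⟨ρ, hρ0, κ / 4, by positivity, ?_⟩
  have hsum : Tendsto (fun n : ℕ => ∑ p ∈ hFfin.toFinset,
      P {ω | -(κ / 4) ≤ (∑ i ∈ Finset.range n, U p (X i ω)) / n}) atTop (𝓝 0) := by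
    simpa using tendsto_finsetSum hFfin.toFinset fun p hp => hlim p (hFfin.mem_toFinset.1 hp)
  refine tendsto_of_tendsto_of_tendsto_of_le_of_le tendsto_const_nhds hsum
    (fun n => zero_le) (fun n => ?_)
  -- The event is a union over uncountably many parameters and need not be measurable; monotonicity
  -- and finite subadditivity suffice.
  refine le_trans (measure_mono_ae ?_) (measure_biUnion_finset_le _ _)
  filter_upwards [h.ae_sample_mem hident hK hZK] with ω hω
  rintro ⟨θ', ⟨hθ'Θ, hθ'⟩, Λ, hΛ, hle⟩
  obtain ⟨p, hp, hpΛ⟩ := hFcov Λ hΛ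
  refine mem_iUnion₂.2 ⟨p, hFfin.mem_toFinset.2 hp, hle.trans ?_⟩
  refine div_le_div_of_nonneg_right (Finset.sum_le_sum fun i _ => ?_) (Nat.cast_nonneg n)
  obtain ⟨hi1, hi2⟩ := hω i
  have hlip := abs_logLikBound_sub_le (hR _ hi1 hi2) (hl0 _ hi1) hR1 (hΛ.2.2 hi1)
    ((hF p hp).2.1 _) ((le_abs_self _).trans (hB θ' hθ'Θ _ hi2))
    ((le_abs_self _).trans (hB θ hθΘ _ hi2)) (hA _ hi2)
  have hnorm : ‖θ' - θ‖ ≤ ρ := by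
    rw [← dist_eq_norm]; exact (Metric.mem_ball.1 hθ').le
  have h7 : L * (|Λ (X i ω).1 - p.1 (X i ω).1| + M * A * ‖θ' - θ‖) ≤
      L * (p.2 (X i ω).1 + M * A * ρ) := by
    refine mul_le_mul_of_nonneg_left (add_le_add (hpΛ _ hi1) ?_) hL0.le
    exact mul_le_mul_of_nonneg_left hnorm (by positivity)
  have h8 := (le_abs_self _).trans (hlip.trans h7)
  simp only [U]
  linarith

/-- The property passes to subsets and to finite unions (with the smaller `c`) and holds locally at
each `θ ≠ θ₀`, so it holds on the compact set `Θ` minus the ball. -/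
lemma exists_tendsto_measure_of_dist_le (h : CoxCurrentStatus P₀ Y T Z Θ θ₀ Λ₀ σ τ M)
    (hindep : iIndepFun X P) (hident : ∀ i, IdentDistrib (X i) (currentStatus Y T Z) P P₀)
    {K : Set (Covariate d)} (hK : IsCompact K) (hZK : ∀ᵐ ω ∂P₀, Z ω ∈ K) {A B R : ℝ}
    (hA : ∀ z ∈ K, ‖z‖ ≤ A) (hB : ∀ θ ∈ Θ, ∀ z ∈ K, |inner ℝ θ z| ≤ B) (hR1 : 1 ≤ R)
    (hR : ∀ x : Obs d, x.1 ∈ Icc σ τ → x.2.2 ∈ K → 1 ≤ R * lik θ₀ Λ₀ x)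
    {ε : ℝ} (hε : 0 < ε) :
    ∃ c > 0, Tendsto (fun n : ℕ => P {ω | ∃ θ ∈ Θ \ Metric.ball θ₀ ε, ∃ Λ ∈ hazardSpace σ τ M,
      -c ≤ (∑ i ∈ Finset.range n, logLikBound R θ₀ Λ₀ θ Λ (X i ω)) / n}) atTop (𝓝 0) := by
  have hcomp : IsCompact (Θ \ Metric.ball θ₀ ε) := h.isCompact_Θ.diff Metric.isOpen_ball
  refine hcomp.induction_on (p := fun S => ∃ c > 0, Tendsto (fun n : ℕ => P {ω | ∃ θ ∈ S,
    ∃ Λ ∈ hazardSpace σ τ M,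
      -c ≤ (∑ i ∈ Finset.range n, logLikBound R θ₀ Λ₀ θ Λ (X i ω)) / n}) atTop (𝓝 0)) ?_ ?_ ?_ ?_
  · exact ⟨1, one_pos, by simp⟩
  · rintro s t hst ⟨c, hc, hlim⟩
    refine ⟨c, hc, tendsto_of_tendsto_of_tendsto_of_le_of_le tendsto_const_nhds hlim
      (fun n => zero_le) (fun n => measure_mono ?_)⟩
    rintro ω ⟨θ, hθ, H⟩
    exact ⟨θ, hst hθ, H⟩
  · rintro s t ⟨c₁, hc₁, hlim₁⟩ ⟨c₂, hc₂, hlim₂⟩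
    have hadd := hlim₁.add hlim₂
    rw [add_zero] at hadd
    refine ⟨min c₁ c₂, lt_min hc₁ hc₂, tendsto_of_tendsto_of_tendsto_of_le_of_le
      tendsto_const_nhds hadd (fun n => zero_le)
      (fun n => le_trans (measure_mono ?_) (measure_union_le _ _))⟩
    rintro ω ⟨θ, hθ | hθ, Λ, hΛ, H⟩
    · exact Or.inl ⟨θ, hθ, Λ, hΛ, (neg_le_neg (min_le_left _ _)).trans H⟩
    · exact Or.inr ⟨θ, hθ, Λ, hΛ, (neg_le_neg (min_le_right _ _)).trans H⟩
  · rintro θ ⟨hθΘ, hθ⟩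
    have hne : θ ≠ θ₀ := fun h0 => hθ (h0 ▸ Metric.mem_ball_self hε)
    obtain ⟨ρ, hρ, c, hc, hlim⟩ :=
      h.exists_nhds_tendsto_measure hindep hident hK hZK hA hB hR1 hR hθΘ hne
    refine ⟨Θ ∩ Metric.ball θ ρ, ?_, c, hc, hlim⟩
    exact inter_mem (mem_of_superset self_mem_nhdsWithin sdiff_subset)
      (mem_nhdsWithin_of_mem_nhds (Metric.ball_mem_nhds θ hρ))

end CoxCurrentStatus

/-! ### From the profile likelihood to consistency. -/

lemma fullLik_mem_Icc {d n : ℕ} {σ τ M : ℝ} {x : Fin n → Obs d} (hx : ∀ i, (x i).1 ∈ Icc σ τ)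
    (θ : Covariate d) {Λ : ℝ → ℝ} (hΛ : Λ ∈ hazardSpace σ τ M) : fullLik x θ Λ ∈ Icc 0 1 :=
  ⟨Finset.prod_nonneg fun i _ => (lik_mem_Icc (hΛ.2.2 (hx i)).1).1,
    Finset.prod_le_one (fun i _ => (lik_mem_Icc (hΛ.2.2 (hx i)).1).1)
      fun i _ => (lik_mem_Icc (hΛ.2.2 (hx i)).1).2⟩

lemma fullLik_le_profileLik {d n : ℕ} {σ τ M : ℝ} {x : Fin n → Obs d}
    (hx : ∀ i, (x i).1 ∈ Icc σ τ) (θ : Covariate d) {Λ : ℝ → ℝ} (hΛ : Λ ∈ hazardSpace σ τ M) :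
    fullLik x θ Λ ≤ profileLik σ τ M x θ := by
  refine le_csSup ⟨1, ?_⟩ (mem_image_of_mem _ hΛ)
  rintro _ ⟨Λ', hΛ', rfl⟩
  exact (fullLik_mem_Icc hx θ hΛ').2

/-- The profile likelihood difference is bounded by the mean of the majorant of the log likelihood
ratio at some near maximizer. -/
lemma exists_profileDiff_le {d n : ℕ} {σ τ M R : ℝ} {Θ : Set (Covariate d)} {θ₀ θ θhat : Covariate d}
    {Λ₀ : ℝ → ℝ} {x : Fin n → Obs d} (hx : ∀ i, (x i).1 ∈ Icc σ τ)
    (hΛ₀ : Λ₀ ∈ hazardSpace σ τ M) (hΛ₀pos : ∀ y ∈ Icc σ τ, 0 < Λ₀ y) (hθ₀ : θ₀ ∈ Θ)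
    (hR : ∀ i, 1 ≤ R * lik θ₀ Λ₀ (x i)) (hhat : IsMLE σ τ M Θ x θhat) :
    ∃ Λ ∈ hazardSpace σ τ M, profileDiff σ τ M x θhat θ ≤
      (∑ i, logLikBound R θ₀ Λ₀ θ Λ (x i)) / n + (n : ℝ)⁻¹ := by
  have hpos : ∀ θ' i, 0 < lik θ' Λ₀ (x i) := fun θ' i => lik_pos (hΛ₀pos _ (hx i))
  have hfull : ∀ θ', 0 < fullLik x θ' Λ₀ := fun θ' => Finset.prod_pos fun i _ => hpos θ' i
  have hpl : 0 < profileLik σ τ M x θ :=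
    (hfull θ).trans_le (fullLik_le_profileLik hx θ hΛ₀)
  obtain ⟨-, Λhat, hΛhat, hmax⟩ := hhat
  have hplhat : Real.log (fullLik x θ₀ Λ₀) ≤ Real.log (profileLik σ τ M x θhat) :=
    Real.log_le_log (hfull θ₀)
      ((hmax θ₀ hθ₀ Λ₀ hΛ₀).trans (fullLik_le_profileLik hx θhat hΛhat))
  -- Attainment of the supremum at `θ` is not needed: a `Λ` within a factor `e⁻¹` of it costs `1` in
  -- the logarithm, hence `1/n` after scaling.
  have hlt : Real.exp (-1) * profileLik σ τ M x θ < profileLik σ τ M x θ :=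
    mul_lt_of_lt_one_left hpl (Real.exp_lt_one_iff.2 (by norm_num))
  obtain ⟨_, ⟨Λ, hΛ, rfl⟩, hΛlt⟩ := exists_lt_of_lt_csSup ⟨_, mem_image_of_mem _ hΛ₀⟩ hlt
  have hfpos : 0 < fullLik x θ Λ := (mul_pos (Real.exp_pos _) hpl).trans hΛlt
  have hlog : Real.log (profileLik σ τ M x θ) - 1 ≤ Real.log (fullLik x θ Λ) := by
    have := Real.log_le_log (mul_pos (Real.exp_pos _) hpl) hΛlt.le
    rw [Real.log_mul (Real.exp_pos _).ne' hpl.ne', Real.log_exp] at this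
    linarith
  -- Although `Λ` may vanish somewhere, a positive product forces every factor to be positive, so
  -- the logarithm splits.
  have hlik : ∀ i, 0 < lik θ Λ (x i) := fun i =>
    lt_of_le_of_ne (lik_mem_Icc (hΛ.2.2 (hx i)).1).1
      (Finset.prod_ne_zero_iff.1 hfpos.ne' i (Finset.mem_univ i)).symm
  have hsum : Real.log (fullLik x θ Λ) - Real.log (fullLik x θ₀ Λ₀) ≤
      ∑ i, logLikBound R θ₀ Λ₀ θ Λ (x i) := by
    unfold fullLik
    rw [Real.log_prod fun i _ => (hlik i).ne', Real.log_prod fun i _ => (hpos θ₀ i).ne',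
      ← Finset.sum_sub_distrib]
    exact Finset.sum_le_sum fun i _ =>
      log_div_le_logLikBound (hR i) (hpos θ₀ i) (hΛ.2.2 (hx i)).1 (hlik i)
  refine ⟨Λ, hΛ, ?_⟩
  have hn : (0 : ℝ) ≤ (n : ℝ)⁻¹ := inv_nonneg.2 (Nat.cast_nonneg n)
  calc profileDiff σ τ M x θhat θ
      ≤ (n : ℝ)⁻¹ * (∑ i, logLikBound R θ₀ Λ₀ θ Λ (x i) + 1) :=
        mul_le_mul_of_nonneg_left (by linarith) hn
    _ = _ := by ring

theorem lemma3 {d : ℕ} {Ω₀ : Type*} [MeasurableSpace Ω₀] [StandardBorelSpace Ω₀]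
    (P₀ : Measure Ω₀) [IsProbabilityMeasure P₀] (Y T : Ω₀ → ℝ) (Z : Ω₀ → Covariate d)
    (Θ : Set (Covariate d)) (θ₀ : Covariate d) (Λ₀ : ℝ → ℝ) (σ τ M : ℝ)
    (hmodel : CoxCurrentStatus P₀ Y T Z Θ θ₀ Λ₀ σ τ M)
    {Ω : Type*} [MeasurableSpace Ω] (P : Measure Ω) [IsProbabilityMeasure P]
    (X : ℕ → Ω → Obs d) (hindep : iIndepFun X P)
    (hident : ∀ i, IdentDistrib (X i) (currentStatus Y T Z) P P₀)
    (θhat : ℕ → Ω → Covariate d)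
    (hθhat : ∀ n, ∀ᵐ ω ∂P, IsMLE σ τ M Θ (sample X n ω) (θhat n ω))
    (θtilde : ℕ → Ω → Covariate d)
    (hθtilde : ∀ n, ∀ᵐ ω ∂P, θtilde n ω ∈ Θ)
    (hΔ : TendstoInMeasure P
      (fun n ω => profileDiff σ τ M (sample X n ω) (θhat n ω) (θtilde n ω)) atTop
      (fun _ => (0 : ℝ))) :
    TendstoInMeasure P θtilde atTop (fun _ => θ₀) := by
  have hθ₀ : θ₀ ∈ Θ := interior_subset hmodel.θ₀_mem
  obtain ⟨K, hK, hZK⟩ := hmodel.compact_Z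
  obtain ⟨A, hA⟩ := hK.isBounded.exists_norm_le
  obtain ⟨A', hA'⟩ := hmodel.isCompact_Θ.isBounded.exists_norm_le
  have hB : ∀ θ ∈ Θ, ∀ z ∈ K, |inner ℝ θ z| ≤ A' * A := fun θ hθ z hz =>
    (abs_real_inner_le_norm _ _).trans
      (mul_le_mul (hA' θ hθ) (hA z hz) (norm_nonneg _) ((norm_nonneg _).trans (hA' θ hθ)))
  obtain ⟨R, hR1, hR⟩ := hmodel.exists_le_lik (hB θ₀ hθ₀)
  rw [tendstoInMeasure_iff_dist]
  intro ε hε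
  obtain ⟨c, hc, hbad⟩ :=
    hmodel.exists_tendsto_measure_of_dist_le hindep hident hK hZK hA hB hR1 hR hε
  -- If `θtilde` is at distance at least `ε` and the uniform bound holds, then `Δ_n < -c + 1/n < -c
  -- / 2` for large `n`; this has vanishing probability by assumption.
  have hΔc := tendstoInMeasure_iff_dist.1 hΔ (c / 2) (half_pos hc)
  have hlim := hΔc.add hbad
  rw [add_zero] at hlim
  have hsmall : ∀ᶠ n : ℕ in atTop, (n : ℝ)⁻¹ < c / 2 :=
    tendsto_inv_atTop_nhds_zero_nat.eventually (gt_mem_nhds (half_pos hc))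
  refine tendsto_of_tendsto_of_tendsto_of_le_of_le' tendsto_const_nhds hlim
    (Eventually.of_forall fun n => zero_le) ?_
  filter_upwards [hsmall] with n hn
  refine le_trans (measure_mono_ae ?_) (measure_union_le _ _)
  filter_upwards [hmodel.ae_sample_mem hident hK hZK, hθhat n, hθtilde n] with ω hω hhat htil hdist
  by_cases hB' : ∃ θ ∈ Θ \ Metric.ball θ₀ ε, ∃ Λ ∈ hazardSpace σ τ M,
      -c ≤ (∑ i ∈ Finset.range n, logLikBound R θ₀ Λ₀ θ Λ (X i ω)) / n
  · exact Or.inr hB'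
  refine Or.inl ?_
  obtain ⟨Λ, hΛ, hle⟩ := exists_profileDiff_le (x := sample X n ω) (θ := θtilde n ω)
    (fun i => (hω i).1) hmodel.Λ₀_mem_hazardSpace
    (fun y hy => hmodel.Λ₀_pos.trans_le (hmodel.Λ₀_mem_Icc hy).1) hθ₀
    (fun i => hR _ (hω i).1 (hω i).2) hhat
  have hnot : ¬ -c ≤ (∑ i ∈ Finset.range n, logLikBound R θ₀ Λ₀ (θtilde n ω) Λ (X i ω)) / n :=
    fun hcon => hB' ⟨_, ⟨htil, fun hball => absurd (Metric.mem_ball.1 hball) (not_lt.2 hdist)⟩,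
      Λ, hΛ, hcon⟩
  have hfin : ∑ i, logLikBound R θ₀ Λ₀ (θtilde n ω) Λ (sample X n ω i) =
      ∑ i ∈ Finset.range n, logLikBound R θ₀ Λ₀ (θtilde n ω) Λ (X i ω) :=
    Fin.sum_univ_eq_sum_range (fun i => logLikBound R θ₀ Λ₀ (θtilde n ω) Λ (X i ω)) n
  rw [hfin] at hle
  rw [mem_ofPred_eq, Real.dist_eq, sub_zero]
  refine le_trans ?_ (neg_le_abs _)
  linarith [not_le.1 hnot]
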